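/- Let $d\ge 1$, let $\|\cdot\|$ be the Euclidean norm on $\mathbb R^d$, and for $c>0$ let $\varphi_c(r)=(r^2+c^2)^{1/2}$ be the multiquadric. A multiquadric cardinal function is a function $\chi_c:\mathbb R^d\to\mathbb R$ of the form $\chi_c(x)=\sum_{j\in\mathbb Z^d}a_j\,\varphi_c(\|x-j\|)$, with real $a_j$ and the series absolutely convergent for every $x\in\mathbb R^d$, such that $\chi_c(k)=\delta_{0,k}$ for all $k\in\mathbb Z^d$. Fourier transforms are normalized by $\hat f(\xi)=\int_{\mathbb R^d} f(x)e^{-ix\cdot\xi}\,dx$, and extended to tempered distributions by $\langle\hat f,\psi\rangle=\langle f,\hat\psi\rangle$ for Schwartz functions $\psi$. For $c>0$ and $r>0$ put $\hat\varphi_c(r)=-\pi^{-1}(2\pi c/r)^{(d+1)/2}K_{(d+1)/2}(cr)$, where $K_\nu(r)=\int_0^\infty e^{-r\cosh t}\cosh(\nu t)\,dt$ is the modified Bessel function. Then: (i) For every $c>0$, $\xi\mapsto\hat\varphi_c(\|\xi\|)$ is the generalized Fourier transform of $x\mapsto\varphi_c(\|x\|)$, that is, its distributional Fourier transform on $\mathbb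 R^d\setminus\{0\}$. For $\xi\notin 2\pi\mathbb Z^d$ the series $\sum_{k\in\mathbb Z^d}\hat\varphi_c(\|\xi+2\pi k\|)$ converges and is nonzero, and the function $$\hat\chi_c(\xi)=\frac{\hat\varphi_c(\|\xi\|)}{\sum_{k\in\mathbb Z^d}\hat\varphi_c(\|\xi+2\pi k\|)},\qquad \xi\notin2\pi\mathbb Z^d,$$ extends to a continuous function on $\mathbb R^d$ with $\hat\chi_c(0)=1$ and $\hat\chi_c(2\pi k)=0$ for $k\in\mathbb Z^d\setminus\{0\}$. (ii) For every $c>0$, $\hat\chi_c$ is the distributional Fourier transform of every multiquadric cardinal function $\chi_c$, and $\hat\chi_c(\xi)=\int_{\mathbb R^d}\chi_c(x)e^{-ix\cdot\xi}\,dx$ for all $\xi$ if $\chi_c$ is absolutely integrable. (iii) For every fixed $\xi\in\mathbb R^d$ with $\|\xi\|_\infty\ne\pi$, $$\lim_{c\to\infty}\hat\chi_c(\xi)=\begin{cases}1,&\xi\in[-\pi,\pi]^d,\\ 0,&\xi\notin[-\pi,\pi]^d.\end{cases}$$ (iv) If $d=1$ and $\chi_c$ is a multiquadric cardinal function for every $c>0$,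 then $\lim_{c\to\infty}\chi_c(x)=\operatorname{sinc}(x)=\sin(\pi x)/(\pi x)$ (equal to $1$ at $x=0$) for every $x\in\mathbb R$. -/

import Mathlib

open scoped SchwartzMap Topology

noncomputable section

namespace MQ

/-- `ℝ^d` with the Euclidean norm. -/
abbrev E (d : ℕ) : Type := EuclideanSpace ℝ (Fin d)

/-- The point of the integer lattice `ℤ^d ⊆ ℝ^d` with integer coordinates `j`. -/
def lat {d : ℕ} (j : Fin d → ℤ) : E d := WithLp.toLp 2 (fun i => (j i : ℝ))

/-- The Fourier integral `f̂(ξ) = ∫ f(x) exp(-i x·ξ) dx`. -/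
def fourierInt {d : ℕ} (f : E d → ℂ) (ξ : E d) : ℂ :=
  ∫ x, f x * Complex.exp (-(Complex.I * ((inner ℝ x ξ : ℝ) : ℂ)))

/-- `⟨f, ψ̂⟩ = ⟨g, ψ⟩`, with both pairings given by absolutely convergent integrals. -/
def PairsWith {d : ℕ} (f g : E d → ℝ) (ψ : 𝓢(E d, ℂ)) : Prop :=
  MeasureTheory.Integrable (fun x => (f x : ℂ) * fourierInt ψ x) ∧
  MeasureTheory.Integrable (fun ξ => (g ξ : ℂ) * ψ ξ) ∧
  ∫ x, (f x : ℂ) * fourierInt ψ x = ∫ ξ, (g ξ : ℂ) * ψ ξ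

/-- The function `g` is the Fourier transform of `f` in the sense of tempered distributions. -/
def IsFourierTransform {d : ℕ} (f g : E d → ℝ) : Prop :=
  ∀ ψ : 𝓢(E d, ℂ), PairsWith f g ψ

/-- The function `g` on `ℝ^d ∖ {0}` is the generalized Fourier transform of `f`: away from the
origin the distributional Fourier transform of `f` is `g`.  The value `g 0` plays no role. -/
def IsGeneralizedFourierTransform {d : ℕ} (f g : E d → ℝ) : Prop :=
  ∀ ψ : 𝓢(E d, ℂ), (0 : E d) ∉ tsupport (ψ : E d → ℂ) → PairsWith f g ψ

/-- `χ` is a cardinal function for the radial function `φ`: it is a sum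
`χ(x) = ∑_{j ∈ ℤ^d} a_j φ(‖x - j‖)`, absolutely convergent for every `x`, with real coefficients,
and `χ(k) = δ_{0,k}` on the lattice. -/
def IsCardinalFunction {d : ℕ} (φ : ℝ → ℝ) (χ : E d → ℝ) : Prop :=
  ∃ a : (Fin d → ℤ) → ℝ,
    (∀ x : E d, HasSum (fun j : Fin d → ℤ => a j * φ ‖x - lat j‖) (χ x)) ∧
    ∀ k : Fin d → ℤ, χ (lat k) = if k = 0 then 1 else 0

/-- The Hardy multiquadric `φ_c(r) = (r² + c²)^{1/2}`. -/
def multiquadric (c r : ℝ) : ℝ := Real.sqrt (r ^ 2 + c ^ 2)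

/-- The modified Bessel function of the second kind
`K_ν(r) = ∫_0^∞ exp(-r cosh t) cosh(ν t) dt`, for `r > 0`. -/
def besselK (ν r : ℝ) : ℝ :=
  ∫ t in Set.Ioi (0 : ℝ), Real.exp (-(r * Real.cosh t)) * Real.cosh (ν * t)

/-- `φ̂_c(r) = -π⁻¹ (2πc/r)^{(d+1)/2} K_{(d+1)/2}(c r)`, for `c, r > 0`. -/
def multiquadricHat (d : ℕ) (c r : ℝ) : ℝ :=
  -(Real.pi)⁻¹ * (2 * Real.pi * c / r) ^ (((d : ℝ) + 1) / 2) *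
    besselK (((d : ℝ) + 1) / 2) (c * r)

open Classical in
/-- `χ̂_c(ξ) = φ̂_c(‖ξ‖) / ∑_{k ∈ ℤ^d} φ̂_c(‖ξ + 2πk‖)`.  At the points of `2πℤ^d` one term of the
sum is infinite, and the quotient is read by continuity, as `1` at the origin and as `0` at the
other points. -/
def cardinalHat (d : ℕ) (c : ℝ) (ξ : E d) : ℝ :=
  if ξ = 0 then 1
  else if ∃ k : Fin d → ℤ, ξ + (2 * Real.pi) • lat k = 0 then 0
  else multiquadricHat d c ‖ξ‖ / ∑' k : Fin d → ℤ, multiquadricHat d c ‖ξ + (2 * Real.pi) • lat k‖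

/-- The cube `[-π, π]^d`. -/
def cube (d : ℕ) : Set (E d) := {ξ | ∀ i, ξ i ∈ Set.Icc (-Real.pi) Real.pi}

end MQ

end

/-!
The multiquadric is a mixture of Gaussians up to a constant: `√s = (2√π)⁻¹ ∫₀^∞ (1 - exp(-st))
t^(-3/2) dt` (`integral_one_sub_exp_mul_rpow`) with `s = ‖x‖² + c²`. Tested against a complex
measure that annihilates constants, the `1` drops out, the Gaussians are transformed one by one,
and the mixture of the transformed Gaussians is the Bessel function in `φ̂_c`
(`integral_mixKernel`). The resulting identity, `integral_mul_multiquadric`, is applied three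
times: to the measure `ψ̂ dx`, which gives the generalized Fourier transform of `φ_c`; to finitely
supported combinations of the interpolation conditions; and to `∑ a_j δ_{x-j}`.

From `cosh ≥ 1` in the integral defining `K_ν` one reads off `K_ν(y) ≤ exp(-(y - x)) K_ν(x)` for
`x ≤ y` (`besselK_le_exp_mul`), hence the same kind of bound for `φ̂_c` (`negHat_le_exp_mul`).
This is the only decay estimate needed: it gives convergence of the lattice sums, integrability of
`χ̂_c`, and the limits `c → ∞`. Continuity of `χ̂_c` on the lattice follows from writing the
quotient in terms of `1 / φ̂_c`, which is continuous with value `0` at the origin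
(`cardinalHat_eq_of_near`).

For a cardinal function with coefficients `a_j` put `A(ξ) = ∑ a_j exp(-i j·ξ)`. Let `Q` be a
trigonometric polynomial that vanishes only on `2πℤ^d`, to such an order that `Q φ̂_c` is
integrable. Combining the interpolation conditions with the coefficients of `exp(i n·ξ) Q` shows
that `Q A φ̂_c - Q 1_{(0,2π]^d}` has a Fourier transform vanishing on `ℤ^d`. By the uniqueness
theorem for Fourier coefficients of integrable functions on the torus (`ae_tsum_add_lat_eq_zero`,
from the density of trigonometric polynomials in the continuous functions) its periodization
vanishes, that is, `A(ξ) ∑_k φ̂_c(ξ + 2πk) = 1` almost everywhere. Thus `A φ̂_c = χ̂_c`, and `∑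
a_j = A(0) = 0` because `|A| ≤ 1 / |φ̂_c|`. The third application of the identity now says that
the cardinal function is the inverse Fourier integral of `χ̂_c`
(`IsCardinalFunction.eq_integral`), pointwise. No distribution supported at the origin has to be
excluded, and the remaining claims follow by Fourier inversion and by dominated convergence.
-/

noncomputable section

namespace MQ

open MeasureTheory Set Filter
open scoped FourierTransform

variable {d : ℕ} {c : ℝ}

/-! ### Modified Bessel functions and the decay of `φ̂_c` -/

/-- From `exp y ≥ y ^ n / n!` and `cosh t ≥ exp t / 2`: one bound that serves both for integrability
in `t` and for the growth as `x → 0`. -/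
theorem besselK_integrand_le {ν x t : ℝ} (hν : 0 ≤ ν) (hx : 0 < x) (ht : 0 ≤ t) (n : ℕ) :
    Real.exp (-(x * Real.cosh t)) * Real.cosh (ν * t) ≤
      n.factorial * (2 / x) ^ n * Real.exp (-((n - ν) * t)) := by
  have hcosh : Real.exp t / 2 ≤ Real.cosh t := by
    rw [Real.cosh_eq]; linarith [Real.exp_pos (-t)]
  have h1 : (x * (Real.exp t / 2)) ^ n / n.factorial ≤ Real.exp (x * Real.cosh t) :=
    (div_le_div_of_nonneg_right (pow_le_pow_left₀ (by positivity)
      (mul_le_mul_of_nonneg_left hcosh hx.le) n) (by positivity)).trans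
      (Real.pow_div_factorial_le_exp _ (by positivity) n)
  have h2 : Real.exp (-(x * Real.cosh t)) ≤ n.factorial * (2 / x) ^ n * Real.exp (-(n * t)) := by
    rw [Real.exp_neg]
    refine (inv_anti₀ (by positivity) h1).trans (le_of_eq ?_)
    rw [Real.exp_neg, Real.exp_nat_mul]
    field_simp
    rw [← mul_pow]
    congr 1
    field_simp
  have h3 : Real.cosh (ν * t) ≤ Real.exp (ν * t) := by
    rw [Real.cosh_eq]
    have : Real.exp (-(ν * t)) ≤ Real.exp (ν * t) := Real.exp_le_exp.2 (by nlinarith)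
    linarith
  calc _ ≤ (n.factorial * (2 / x) ^ n * Real.exp (-(n * t))) * Real.exp (ν * t) :=
        mul_le_mul h2 h3 (Real.cosh_pos _).le (by positivity)
    _ = _ := by rw [mul_assoc, ← Real.exp_add]; ring_nf

theorem integrableOn_exp_neg_mul_const {b : ℝ} (hb : 0 < b) (C : ℝ) :
    IntegrableOn (fun t : ℝ => C * Real.exp (-(b * t))) (Ioi 0) := by
  have := (integrableOn_Ioi_comp_mul_left_iff (fun t => Real.exp (-t)) 0 hb).2
    (by simpa using integrableOn_exp_neg_Ioi (0 : ℝ))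
  exact this.const_mul C

theorem integrableOn_besselK {ν x : ℝ} (hν : 0 ≤ ν) (hx : 0 < x) :
    IntegrableOn (fun t => Real.exp (-(x * Real.cosh t)) * Real.cosh (ν * t)) (Ioi 0) := by
  obtain ⟨n, hn⟩ := exists_nat_gt ν
  refine Integrable.mono' (integrableOn_exp_neg_mul_const (sub_pos.2 hn)
    (n.factorial * (2 / x) ^ n)) (by fun_prop) ?_
  filter_upwards [ae_restrict_mem measurableSet_Ioi] with t ht
  rw [Real.norm_of_nonneg (by positivity)]
  exact besselK_integrand_le hν hx (le_of_lt ht) n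

theorem besselK_le_rpow {ν x : ℝ} (hν : 0 ≤ ν) (hx : 0 < x) {n : ℕ} (hn : ν < n) :
    besselK ν x ≤ (n.factorial * 2 ^ n * ∫ t in Ioi (0 : ℝ), Real.exp (-((n - ν) * t))) / x ^ n :=
        by
  have := setIntegral_mono_on (integrableOn_besselK hν hx)
    (integrableOn_exp_neg_mul_const (sub_pos.2 hn) (n.factorial * (2 / x) ^ n)) measurableSet_Ioi
    (fun t ht => besselK_integrand_le hν hx (le_of_lt ht) n)
  refine this.trans (le_of_eq ?_)
  rw [integral_const_mul, div_pow]
  ring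

theorem besselK_pos {ν x : ℝ} (hν : 0 ≤ ν) (hx : 0 < x) : 0 < besselK ν x := by
  refine (setIntegral_pos_iff_support_of_nonneg_ae ?_ (integrableOn_besselK hν hx)).2 ?_
  · exact Eventually.of_forall fun t => by positivity
  · have : Function.support (fun t => Real.exp (-(x * Real.cosh t)) * Real.cosh (ν * t)) = univ :=
      by
      ext t; simp [Real.exp_ne_zero, (Real.cosh_pos (ν * t)).ne']
    rw [this, univ_inter]; simp

/-- The factor by which `K_ν` decreases, from `cosh ≥ 1` in the defining integral. -/
theorem besselK_le_exp_mul {ν x y : ℝ} (hν : 0 ≤ ν) (hx : 0 < x) (hxy : x ≤ y) :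
    besselK ν y ≤ Real.exp (-(y - x)) * besselK ν x := by
  rw [besselK, besselK, ← integral_const_mul]
  refine setIntegral_mono_on (integrableOn_besselK hν (hx.trans_le hxy))
    ((integrableOn_besselK hν hx).const_mul _) measurableSet_Ioi fun t _ => ?_
  rw [← mul_assoc, ← Real.exp_add]
  refine mul_le_mul_of_nonneg_right (Real.exp_le_exp.2 ?_) (Real.cosh_pos _).le
  nlinarith [Real.one_le_cosh t]

theorem continuousOn_besselK {ν : ℝ} (hν : 0 ≤ ν) : ContinuousOn (besselK ν) (Ioi 0) := by
  intro x hx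
  have hx : 0 < x := hx
  refine ContinuousAt.continuousWithinAt ?_
  refine continuousAt_of_dominated (bound := fun t =>
    Real.exp (-(x / 2 * Real.cosh t)) * Real.cosh (ν * t))
    (Eventually.of_forall fun y => by fun_prop) ?_ (integrableOn_besselK hν (half_pos hx)) ?_
  · filter_upwards [lt_mem_nhds (half_lt_self hx)] with y hy
    refine Eventually.of_forall fun t => ?_
    rw [Real.norm_of_nonneg (by positivity)]
    refine mul_le_mul_of_nonneg_right (Real.exp_le_exp.2 ?_) (Real.cosh_pos _).le
    nlinarith [Real.one_le_cosh t]
  · exact Eventually.of_forall fun t => by fun_prop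

/-- `-φ̂_c`, a positive function on `(0, ∞)`.  At `r = 0`, where `φ̂_c` is singular, the formula has
the value `0`, because division by zero gives zero. -/
def negHat (d : ℕ) (c r : ℝ) : ℝ :=
  (Real.pi)⁻¹ * (2 * Real.pi * c / r) ^ (((d : ℝ) + 1) / 2) *
    besselK (((d : ℝ) + 1) / 2) (c * r)

theorem multiquadricHat_eq_neg (d : ℕ) (c r : ℝ) : multiquadricHat d c r = -negHat d c r := by
  simp [multiquadricHat, negHat]

theorem order_pos (d : ℕ) : 0 < ((d : ℝ) + 1) / 2 := by positivity

@[simp] theorem negHat_zero (d : ℕ) (c : ℝ) : negHat d c 0 = 0 := by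
  simp [negHat, Real.zero_rpow (order_pos d).ne']


theorem negHat_pos (hc : 0 < c) {r : ℝ} (hr : 0 < r) : 0 < negHat d c r := by
  have := besselK_pos (order_pos d).le (mul_pos hc hr)
  unfold negHat; positivity

theorem negHat_nonneg (hc : 0 < c) {r : ℝ} (hr : 0 ≤ r) : 0 ≤ negHat d c r := by
  rcases hr.eq_or_lt with rfl | hr
  · simp
  · exact (negHat_pos hc hr).le

theorem negHat_le_exp_mul (hc : 0 < c) {r s : ℝ} (hr : 0 < r) (hrs : r ≤ s) :
    negHat d c s ≤ Real.exp (-(c * (s - r))) * negHat d c r := by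
  have hs := hr.trans_le hrs
  have h1 : (2 * Real.pi * c / s) ^ (((d : ℝ) + 1) / 2) ≤
      (2 * Real.pi * c / r) ^ (((d : ℝ) + 1) / 2) :=
    Real.rpow_le_rpow (by positivity) (by gcongr) (order_pos d).le
  have h2 := besselK_le_exp_mul (order_pos d).le (mul_pos hc hr)
      (mul_le_mul_of_nonneg_left hrs hc.le)
  have h3 := (besselK_pos (order_pos d).le (mul_pos hc hs)).le
  calc negHat d c s ≤ (Real.pi)⁻¹ * (2 * Real.pi * c / r) ^ (((d : ℝ) + 1) / 2) *
        (Real.exp (-(c * s - c * r)) * besselK (((d : ℝ) + 1) / 2) (c * r)) := by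
        unfold negHat; gcongr
    _ = _ := by unfold negHat; ring_nf

theorem continuousOn_negHat (hc : 0 < c) : ContinuousOn (negHat d c) (Ioi 0) := by
  refine ContinuousOn.mul (continuousOn_const.mul ?_) ?_
  · refine ContinuousOn.rpow_const (continuousOn_const.div continuousOn_id fun r hr =>
      ne_of_gt hr) ?_
    exact fun r _ => Or.inr (order_pos d).le
  · exact (continuousOn_besselK (order_pos d).le).comp (by fun_prop) fun r hr => mul_pos hc hr

theorem measurable_negHat_norm (hc : 0 < c) : Measurable (fun ξ : E d => negHat d c ‖ξ‖) := by
  have : ContinuousOn (fun ξ : E d => negHat d c ‖ξ‖) {0}ᶜ :=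
    (continuousOn_negHat hc).comp (by fun_prop) fun ξ hξ => norm_pos_iff.2 hξ
  classical
  have h := this.measurable_piecewise (g := fun _ : E d => 0) continuousOn_const
    (measurableSet_singleton (0 : E d)).compl
  convert h using 1
  ext ξ
  by_cases hξ : ξ = 0 <;> simp [hξ, Set.piecewise]

/-- Near the origin the growth of `φ̂_c` is at most polynomial.  The exponent is not sharp
(`φ̂_c` grows like `r ^ (-(d + 1))`). -/
theorem exists_negHat_le (d : ℕ) (hc : 0 < c) :
    ∃ C : ℝ, 0 ≤ C ∧ ∀ r, 0 < r → r ≤ 1 → negHat d c r * r ^ (2 * (d + 1)) ≤ C := by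
  have hn : ((d : ℝ) + 1) / 2 < ((d + 1 : ℕ) : ℝ) := by push_cast; linarith [d.cast_nonneg (α := ℝ)]
  obtain ⟨B, hB⟩ : ∃ B : ℝ, ∀ x, 0 < x → besselK (((d : ℝ) + 1) / 2) x ≤ B / x ^ (d + 1) :=
    ⟨_, fun x hx => besselK_le_rpow (order_pos d).le hx hn⟩
  have hB0 : 0 ≤ B := by
    have := (besselK_pos (order_pos d).le one_pos).le.trans (hB 1 one_pos)
    simpa using this
  refine ⟨(Real.pi)⁻¹ * (2 * Real.pi * c) ^ (((d : ℝ) + 1) / 2) * (B / c ^ (d + 1)), by positivity,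
    fun r hr hr1 => ?_⟩
  -- One factor `r ^ (d + 1)` absorbs the Bessel function, the other the power `r ^ (-(d + 1) / 2)`.
  have h2 : r ^ (2 * (d + 1)) ≤ r ^ (d + 1) * r ^ (((d : ℝ) + 1) / 2) := by
    rw [two_mul, pow_add]
    refine mul_le_mul_of_nonneg_left ?_ (by positivity)
    rw [← Real.rpow_natCast]
    exact Real.rpow_le_rpow_of_exponent_ge hr hr1 hn.le
  calc negHat d c r * r ^ (2 * (d + 1))
      ≤ ((Real.pi)⁻¹ * (2 * Real.pi * c / r) ^ (((d : ℝ) + 1) / 2) * (B / (c * r) ^ (d + 1))) *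
        (r ^ (d + 1) * r ^ (((d : ℝ) + 1) / 2)) := by
        unfold negHat
        have := hB (c * r) (by positivity)
        gcongr
    _ = _ := by
        rw [Real.div_rpow (by positivity) hr.le, mul_pow]
        have : r ^ (((d : ℝ) + 1) / 2) ≠ 0 := (Real.rpow_pos_of_pos hr _).ne'
        field_simp

/-- `1 / φ̂_c` is continuous at the origin too: the value `0⁻¹ = 0` there is the limit, as `φ̂_c` is
unbounded near `0`. -/
theorem continuous_inv_negHat_norm (hc : 0 < c) :
    Continuous (fun ξ : E d => (negHat d c ‖ξ‖)⁻¹) := by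
  rw [continuous_iff_continuousAt]
  intro ξ
  by_cases hξ : ξ = 0
  · subst hξ
    have hK := besselK_pos (order_pos d).le hc
    have hlim : Tendsto (fun ξ : E d => (Real.pi * (besselK (((d : ℝ) + 1) / 2) c)⁻¹ *
        ((‖ξ‖ / (2 * Real.pi * c)) ^ (((d : ℝ) + 1) / 2)))) (𝓝 0) (𝓝 0) := by
      have : Continuous (fun ξ : E d => (Real.pi * (besselK (((d : ℝ) + 1) / 2) c)⁻¹ *
        ((‖ξ‖ / (2 * Real.pi * c)) ^ (((d : ℝ) + 1) / 2)))) :=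
        continuous_const.mul ((continuous_norm.div_const _).rpow_const fun _ =>
            Or.inr (order_pos d).le)
      simpa [Real.zero_rpow (order_pos d).ne'] using this.tendsto 0
    rw [ContinuousAt, norm_zero, negHat_zero, inv_zero]
    refine squeeze_zero' (Eventually.of_forall fun ξ =>
        inv_nonneg.2 (negHat_nonneg hc (norm_nonneg _)))
      ?_ hlim
    filter_upwards [Metric.ball_mem_nhds (0 : E d) one_pos] with ξ hξ
    rw [mem_ball_zero_iff] at hξ
    rcases (norm_nonneg ξ).eq_or_lt with h0 | h0
    · simp [← h0, Real.zero_rpow (order_pos d).ne']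
    · have hcr : c * ‖ξ‖ ≤ c := by nlinarith
      have h1 : besselK (((d : ℝ) + 1) / 2) c ≤ besselK (((d : ℝ) + 1) / 2) (c * ‖ξ‖) := by
        have hp := besselK_pos (order_pos d).le (mul_pos hc h0)
        refine (besselK_le_exp_mul (order_pos d).le (mul_pos hc h0) hcr).trans ?_
        refine mul_le_of_le_one_left hp.le (Real.exp_le_one_iff.2 (by linarith))
      have h2 : (‖ξ‖ / (2 * Real.pi * c)) ^ (((d : ℝ) + 1) / 2) =
          ((2 * Real.pi * c / ‖ξ‖) ^ (((d : ℝ) + 1) / 2))⁻¹ := by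
        rw [← Real.inv_rpow (by positivity), inv_div]
      rw [h2, negHat, mul_inv, mul_inv, inv_inv]
      have := inv_anti₀ hK h1
      calc _ ≤ Real.pi * ((2 * Real.pi * c / ‖ξ‖) ^ (((d : ℝ) + 1) / 2))⁻¹ *
            (besselK (((d : ℝ) + 1) / 2) c)⁻¹ := by gcongr
        _ = _ := by ring
  · have h0 := norm_pos_iff.2 hξ
    refine ContinuousAt.inv₀ ?_ (negHat_pos hc h0).ne'
    exact ((continuousOn_negHat hc).continuousAt (Ioi_mem_nhds h0)).comp
        continuous_norm.continuousAt

/-! ### The multiquadric and its transform as mixtures of Gaussians -/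

/-- The square root as a mixture of exponentials, `√s = (2√π)⁻¹ ∫ (1 - exp(-st)) t^(-3/2) dt`. -/
theorem integral_one_sub_exp_mul_rpow {s : ℝ} (hs : 0 < s) :
    IntegrableOn (fun t : ℝ => (1 - Real.exp (-(s * t))) * t ^ (-3 / 2 : ℝ)) (Ioi 0) ∧
    ∫ t in Ioi (0 : ℝ), (1 - Real.exp (-(s * t))) * t ^ (-3 / 2 : ℝ) =
      2 * Real.sqrt Real.pi * Real.sqrt s := by
  have hle : ∀ t, 1 - Real.exp (-(s * t)) ≤ s * t := fun t => by
    linarith [Real.add_one_le_exp (-(s * t))]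
  have hnn : ∀ t, 0 ≤ t → 0 ≤ 1 - Real.exp (-(s * t)) := fun t ht => by
    have : Real.exp (-(s * t)) ≤ 1 := Real.exp_le_one_iff.2 (by nlinarith)
    linarith
  have hmeas : ∀ S : Set ℝ, AEStronglyMeasurable
      (fun t : ℝ => (1 - Real.exp (-(s * t))) * t ^ (-3 / 2 : ℝ)) (volume.restrict S) := fun S =>
    (by fun_prop : Measurable _).aestronglyMeasurable
  have hint : IntegrableOn (fun t : ℝ => (1 - Real.exp (-(s * t))) * t ^ (-3 / 2 : ℝ)) (Ioi 0) := by
    rw [← Ioc_union_Ioi_eq_Ioi zero_le_one]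
    refine IntegrableOn.union ?_ ?_
    · have h1 : IntegrableOn (fun t : ℝ => s * t ^ (-1 / 2 : ℝ)) (Ioc 0 1) := by
        have := (intervalIntegral.intervalIntegrable_rpow' (a := 0) (b := 1)
          (r := -1 / 2) (by norm_num)).const_mul s
        rwa [intervalIntegrable_iff_integrableOn_Ioc_of_le zero_le_one] at this
      refine Integrable.mono' h1 (hmeas _) ?_
      filter_upwards [ae_restrict_mem measurableSet_Ioc] with t ht
      have := hnn t ht.1.le
      have h0 := ht.1
      rw [Real.norm_of_nonneg (by positivity)]
      calc _ ≤ (s * t) * t ^ (-3 / 2 : ℝ) := by gcongr; exact hle t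
        _ = s * (t ^ (1 : ℝ) * t ^ (-3 / 2 : ℝ)) := by rw [Real.rpow_one]; ring
        _ = _ := by rw [← Real.rpow_add h0]; norm_num
    · refine Integrable.mono' (integrableOn_Ioi_rpow_of_lt (a := -3 / 2) (by norm_num) one_pos)
        (hmeas _) ?_
      filter_upwards [ae_restrict_mem measurableSet_Ioi] with t ht
      have h0 : (0 : ℝ) < t := one_pos.trans ht
      have := hnn t h0.le
      rw [Real.norm_of_nonneg (by positivity)]
      refine mul_le_of_le_one_left (by positivity) ?_
      linarith [Real.exp_pos (-(s * t))]
  refine ⟨hint, ?_⟩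
  have hΓ : IntegrableOn (fun t : ℝ => 2 * s * (t ^ ((1 / 2 : ℝ) - 1) * Real.exp (-(s * t))))
      (Ioi 0) := by
    have h := integrableOn_rpow_mul_exp_neg_mul_rpow (s := (1 / 2 : ℝ) - 1) (p := 1) (b := s)
      (by norm_num) one_pos hs
    simp only [Real.rpow_one, neg_mul] at h
    exact h.const_mul _
  -- Integration by parts, written as the vanishing of a total derivative.
  have key := integral_Ioi_of_hasDerivAt_of_tendsto (a := 0) (m := 0)
    (f := fun t => -2 * ((1 - Real.exp (-(s * t))) * t ^ (-1 / 2 : ℝ)))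
    (f' := fun t => (1 - Real.exp (-(s * t))) * t ^ (-3 / 2 : ℝ) -
      2 * s * (t ^ ((1 / 2 : ℝ) - 1) * Real.exp (-(s * t)))) ?_ ?_ (hint.sub hΓ) ?_
  · rw [integral_sub hint hΓ, integral_const_mul, Real.integral_rpow_mul_exp_neg_mul_Ioi
      (by norm_num) hs] at key
    simp only [mul_zero, neg_zero, Real.exp_zero, sub_self, zero_mul] at key
    rw [sub_eq_zero.1 key, Real.Gamma_one_half_eq, ← Real.sqrt_eq_rpow, Real.sqrt_div zero_le_one,
      Real.sqrt_one]
    have := Real.mul_self_sqrt hs.le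
    have h0 := Real.sqrt_pos.2 hs
    field_simp
    linarith
  · have hlim : Tendsto (fun t : ℝ => 2 * s * t ^ (1 / 2 : ℝ)) (𝓝[≥] 0) (𝓝 0) := by
      have : Continuous (fun t : ℝ => 2 * s * t ^ (1 / 2 : ℝ)) :=
        continuous_const.mul (Real.continuous_rpow_const (by norm_num))
      simpa using (this.tendsto 0).mono_left nhdsWithin_le_nhds
    rw [ContinuousWithinAt]
    simp only [mul_zero, neg_zero, Real.exp_zero, sub_self, zero_mul]
    refine squeeze_zero_norm' ?_ hlim
    filter_upwards [self_mem_nhdsWithin] with t ht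
    rcases (show (0 : ℝ) ≤ t from ht).eq_or_lt with rfl | h0
    · simp
    have := hnn t h0.le
    rw [norm_mul, Real.norm_of_nonneg (show 0 ≤ (1 - Real.exp (-(s * t))) * t ^ (-1 / 2 : ℝ) by
      positivity)]
    calc _ ≤ 2 * ((s * t) * t ^ (-1 / 2 : ℝ)) := by norm_num; gcongr; exact hle t
      _ = 2 * s * (t ^ (1 : ℝ) * t ^ (-1 / 2 : ℝ)) := by rw [Real.rpow_one]; ring
      _ = _ := by rw [← Real.rpow_add h0]; norm_num
  · intro t ht
    have h0 : (0 : ℝ) < t := ht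
    have h1 : HasDerivAt (fun t => Real.exp (-(s * t))) (Real.exp (-(s * t)) * -(s * 1)) t :=
      ((hasDerivAt_id t).const_mul s).neg.exp
    have h2 := Real.hasDerivAt_rpow_const (x := t) (p := -1 / 2) (Or.inl h0.ne')
    refine (((h1.const_sub 1).mul h2).const_mul (-2)).congr_deriv ?_
    norm_num
    ring
  · have hlim : Tendsto (fun t : ℝ => 2 * t ^ (-(1 / 2 : ℝ))) atTop (𝓝 0) := by
      simpa using (tendsto_rpow_neg_atTop (y := 1 / 2) (by norm_num)).const_mul 2
    refine squeeze_zero_norm' ?_ hlim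
    filter_upwards [eventually_gt_atTop 0] with t h0
    have := hnn t h0.le
    rw [norm_mul, Real.norm_of_nonneg (show 0 ≤ (1 - Real.exp (-(s * t))) * t ^ (-1 / 2 : ℝ) by
      positivity), neg_div]
    norm_num
    refine mul_le_of_le_one_left (by positivity) ?_
    linarith [Real.exp_pos (-(s * t))]

/-- The Bessel integral over the whole line, where `cosh(νu)` may be replaced by `exp(-νu)` as
`cosh u` is even. -/
theorem integral_exp_mul_exp_cosh {ν x : ℝ} (hν : 0 ≤ ν) (hx : 0 < x) :
    Integrable (fun u : ℝ => Real.exp (-(ν * u)) * Real.exp (-(x * Real.cosh u))) ∧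
    ∫ u : ℝ, Real.exp (-(ν * u)) * Real.exp (-(x * Real.cosh u)) = 2 * besselK ν x := by
  set f : ℝ → ℝ := fun t => Real.exp (-(x * Real.cosh t)) * Real.cosh (ν * t) with hf
  have habs : ∀ u, f |u| = f u := fun u => by
    simp only [hf, Real.cosh_abs]
    rw [← Real.cosh_abs (ν * |u|), abs_mul, abs_abs, ← abs_mul, Real.cosh_abs]
  have hfi : Integrable f := by
    have h := integrableOn_besselK hν hx
    have : IntegrableOn f (Iic 0) := by
      rw [integrableOn_Iic_iff_integrableOn_Iio]
      rw [← (Measure.measurePreserving_neg (volume : Measure ℝ)).integrableOn_comp_preimage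
        (Homeomorph.neg ℝ).measurableEmbedding] at h
      simpa [hf, Function.comp_def] using h
    rw [← integrableOn_univ, ← Iic_union_Ioi (a := (0 : ℝ))]
    exact this.union h
  have hgi : Integrable (fun u : ℝ => Real.exp (-(ν * u)) * Real.exp (-(x * Real.cosh u))) := by
    refine Integrable.mono' (hfi.const_mul 2) (by fun_prop) (Eventually.of_forall fun u => ?_)
    rw [Real.norm_of_nonneg (by positivity)]
    simp only [hf, Real.cosh_eq (ν * u)]
    nlinarith [Real.exp_pos (-(x * Real.cosh u)), Real.exp_pos (ν * u), mul_pos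
      (Real.exp_pos (-(x * Real.cosh u))) (Real.exp_pos (ν * u))]
  refine ⟨hgi, ?_⟩
  have h1 : ∫ u : ℝ, f u = 2 * besselK ν x := by
    rw [← integral_congr_ae (Eventually.of_forall habs), integral_comp_abs]
    rfl
  have h2 := integral_neg_eq_self
    (fun u : ℝ => Real.exp (-(ν * u)) * Real.exp (-(x * Real.cosh u))) volume
  have h3 : ∫ u : ℝ, f u = (∫ u : ℝ, Real.exp (-(ν * u)) * Real.exp (-(x * Real.cosh u)) +
      Real.exp (-(ν * -u)) * Real.exp (-(x * Real.cosh (-u)))) / 2 := by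
    rw [← integral_div]
    refine integral_congr_ae (Eventually.of_forall fun u => ?_)
    simp only [hf, Real.cosh_neg, Real.cosh_eq (ν * u)]
    ring_nf
  rw [integral_add hgi hgi.comp_neg, h2] at h3
  linarith

/-- The integrand of `φ̂_c` as a mixture of the Gaussians `exp(-r² / 4t)`, up to a constant factor. -/
def mixKernel (d : ℕ) (c r t : ℝ) : ℝ :=
  t ^ (-((d : ℝ) + 3) / 2) * Real.exp (-(t * c ^ 2 + r ^ 2 / (4 * t)))

/-- The Bessel function as a mixture of Gaussians: substitute `t = r / (2c) * exp u`. -/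
theorem integral_mixKernel (d : ℕ) {c r : ℝ} (hc : 0 < c) (hr : 0 < r) :
    IntegrableOn (mixKernel d c r) (Ioi 0) ∧
    ∫ t in Ioi (0 : ℝ), mixKernel d c r t = 2 * Real.pi ^ ((1 - (d : ℝ)) / 2) * negHat d c r := by
  set κ := r / (2 * c) with hκ
  have hκ0 : 0 < κ := by positivity
  have himg : (fun u => κ * Real.exp u) '' univ = Ioi 0 := by
    rw [image_univ]
    ext t
    constructor
    · rintro ⟨u, rfl⟩; exact mul_pos hκ0 (Real.exp_pos u)
    · intro ht
      refine ⟨Real.log (t / κ), ?_⟩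
      simp only
      rw [Real.exp_log (div_pos ht hκ0)]
      field_simp
  have hder : ∀ u ∈ univ, HasDerivWithinAt (fun u => κ * Real.exp u) (κ * Real.exp u) univ u :=
    fun u _ => ((Real.hasDerivAt_exp u).const_mul κ).hasDerivWithinAt
  have hinj : InjOn (fun u => κ * Real.exp u) univ := fun u _ v _ h =>
    Real.exp_injective (mul_left_cancel₀ hκ0.ne' h)
  have hfun : ∀ u : ℝ, |κ * Real.exp u| • mixKernel d c r (κ * Real.exp u) =
      κ ^ (-(((d : ℝ) + 1) / 2)) * (Real.exp (-((((d : ℝ) + 1) / 2) * u)) *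
        Real.exp (-((c * r) * Real.cosh u))) := fun u => by
    have h1 : κ * Real.exp u * c ^ 2 + r ^ 2 / (4 * (κ * Real.exp u)) = (c * r) * Real.cosh u := by
      rw [Real.cosh_eq, Real.exp_neg, hκ]
      have := Real.exp_pos u
      field_simp
      ring
    have hpos : 0 < κ * Real.exp u := by positivity
    rw [mixKernel, h1, abs_of_pos hpos, smul_eq_mul, ← mul_assoc, ← mul_assoc]
    congr 1
    calc _ = (κ * Real.exp u) ^ (1 : ℝ) * (κ * Real.exp u) ^ (-((d : ℝ) + 3) / 2) := by
          rw [Real.rpow_one]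
      _ = (κ * Real.exp u) ^ (-(((d : ℝ) + 1) / 2)) := by rw [← Real.rpow_add hpos]; ring_nf
      _ = _ := by rw [Real.mul_rpow hκ0.le (Real.exp_pos u).le, ← Real.exp_mul]; ring_nf
  obtain ⟨hi, he⟩ := integral_exp_mul_exp_cosh (order_pos d).le (mul_pos hc hr)
  constructor
  · rw [← himg, integrableOn_image_iff_integrableOn_abs_deriv_smul MeasurableSet.univ hder hinj]
    simp_rw [hfun]
    exact (hi.const_mul _).integrableOn
  · rw [← himg, integral_image_eq_integral_abs_deriv_smul MeasurableSet.univ hder hinj]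
    simp_rw [hfun]
    rw [Measure.restrict_univ, integral_const_mul, he, negHat]
    have h2 : (2 * Real.pi * c / r) ^ (((d : ℝ) + 1) / 2) =
        Real.pi ^ (((d : ℝ) + 1) / 2) * κ ^ (-(((d : ℝ) + 1) / 2)) := by
      rw [Real.rpow_neg hκ0.le, ← Real.inv_rpow hκ0.le,
          ← Real.mul_rpow Real.pi_pos.le (by positivity),
        hκ, inv_div]
      ring_nf
    have h3 : Real.pi ^ ((1 - (d : ℝ)) / 2) * (Real.pi⁻¹ * Real.pi ^ (((d : ℝ) + 1) / 2)) = 1 := by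
      rw [← Real.rpow_neg_one, ← Real.rpow_add Real.pi_pos, ← Real.rpow_add Real.pi_pos]
      ring_nf
      exact Real.rpow_zero _
    rw [h2]
    linear_combination (-2 * κ ^ (-(((d : ℝ) + 1) / 2)) * besselK (((d : ℝ) + 1) / 2) (c * r)) * h3

/-! ### The transform of the multiquadric against measures annihilating constants -/

/-- The plane wave `exp(i x·ξ)`. -/
def planeWave (x ξ : E d) : ℂ := Complex.exp (Complex.I * ((inner ℝ x ξ : ℝ) : ℂ))

@[simp] theorem norm_planeWave (x ξ : E d) : ‖planeWave x ξ‖ = 1 := by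
  rw [planeWave, mul_comm, Complex.norm_exp_ofReal_mul_I]

theorem planeWave_comm (x ξ : E d) : planeWave x ξ = planeWave ξ x := by
  rw [planeWave, real_inner_comm, planeWave]

@[fun_prop]
theorem continuous_planeWave_right (x : E d) : Continuous (fun ξ : E d => planeWave x ξ) := by
  unfold planeWave; fun_prop

@[simp] theorem planeWave_zero_right (x : E d) : planeWave x 0 = 1 := by simp [planeWave]

@[simp] theorem planeWave_zero_left (ξ : E d) : planeWave 0 ξ = 1 := by simp [planeWave]

theorem planeWave_add_left (x y ξ : E d) : planeWave (x + y) ξ = planeWave x ξ * planeWave y ξ := by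
  simp only [planeWave, inner_add_left, ← Complex.exp_add]; push_cast; ring_nf

theorem measurable_planeWave {Y : Type*} [MeasurableSpace Y] {f g : Y → E d} (hf : Measurable f)
    (hg : Measurable g) : Measurable (fun y => planeWave (f y) (g y)) := by
  unfold planeWave
  exact Complex.measurable_exp.comp
    ((Complex.measurable_ofReal.comp (hf.inner hg)).const_mul Complex.I)

theorem integral_gaussian_mul_planeWave {t : ℝ} (ht : 0 < t) (x : E d) :
    Integrable (fun ξ : E d => ((Real.exp (-(‖ξ‖ ^ 2 / (4 * t))) : ℝ) : ℂ) * planeWave x ξ) ∧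
    ∫ ξ : E d, ((Real.exp (-(‖ξ‖ ^ 2 / (4 * t))) : ℝ) : ℂ) * planeWave x ξ =
      (((4 * Real.pi * t) ^ ((d : ℝ) / 2) * Real.exp (-(t * ‖x‖ ^ 2)) : ℝ) : ℂ) := by
  have hb : 0 < ((1 / (4 * t) : ℝ) : ℂ).re := by rw [Complex.ofReal_re]; positivity
  have h : ∀ ξ : E d, ((Real.exp (-(‖ξ‖ ^ 2 / (4 * t))) : ℝ) : ℂ) * planeWave x ξ =
      Complex.exp (-((1 / (4 * t) : ℝ) : ℂ) * ‖ξ‖ ^ 2 + Complex.I * ((inner ℝ x ξ : ℝ) : ℂ)) :=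
    fun ξ => by
      rw [planeWave, Complex.ofReal_exp, ← Complex.exp_add]
      push_cast
      congr 1; ring
  simp_rw [h]
  refine ⟨GaussianFourier.integrable_cexp_neg_mul_sq_norm_add hb _ _, ?_⟩
  rw [GaussianFourier.integral_cexp_neg_mul_sq_norm_add hb]
  push_cast
  have ht' : (t : ℂ) ≠ 0 := by exact_mod_cast ht.ne'
  congr 1
  · rw [Complex.ofReal_cpow (by positivity), finrank_euclideanSpace, Fintype.card_fin]
    push_cast
    congr 1
    field_simp
  · congr 1
    rw [Complex.I_sq]
    field_simp

section Mixture

variable {X : Type*} [MeasurableSpace X] {μ : Measure X} [SFinite μ] {w : X → ℂ} {p : X → E d}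

/-- The Parseval identity for a Gaussian and a measure `w dμ` transported by `p`. -/
theorem integral_mul_gaussian (hp : Measurable p) (hw : Integrable w μ) {t : ℝ} (ht : 0 < t) :
    ∫ ξ : E d, (∫ x, w x * planeWave (p x) ξ ∂μ) * ((Real.exp (-(‖ξ‖ ^ 2 / (4 * t))) : ℝ) : ℂ) =
      (((4 * Real.pi * t) ^ ((d : ℝ) / 2) : ℝ) : ℂ) *
        ∫ x, w x * ((Real.exp (-(t * ‖p x‖ ^ 2)) : ℝ) : ℂ) ∂μ := by
  have hg : Integrable (fun ξ : E d => ((Real.exp (-(‖ξ‖ ^ 2 / (4 * t))) : ℝ) : ℂ)) := by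
    simpa using (integral_gaussian_mul_planeWave (d := d) ht 0).1
  have hprod : Integrable (fun z : X × E d => w z.1 * planeWave (p z.1) z.2 *
      ((Real.exp (-(‖z.2‖ ^ 2 / (4 * t))) : ℝ) : ℂ)) (μ.prod volume) := by
    have h1 := hw.mul_prod hg
    have hm : Measurable (fun z : X × E d => planeWave (p z.1) z.2) :=
      measurable_planeWave (hp.comp measurable_fst) measurable_snd
    have h2 : Integrable (fun z : X × E d => planeWave (p z.1) z.2 *
        (w z.1 * ((Real.exp (-(‖z.2‖ ^ 2 / (4 * t))) : ℝ) : ℂ))) (μ.prod volume) :=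
      h1.bdd_mul (c := 1) hm.aestronglyMeasurable
        (Eventually.of_forall fun z => (norm_planeWave _ _).le)
    refine h2.congr (Eventually.of_forall fun z => ?_)
    simp only; ring
  have hswap := integral_integral_swap (f := fun x ξ => w x * planeWave (p x) ξ *
      ((Real.exp (-(‖ξ‖ ^ 2 / (4 * t))) : ℝ) : ℂ)) hprod
  simp_rw [← integral_mul_const]
  rw [← hswap, ← integral_const_mul]
  refine integral_congr_ae (Eventually.of_forall fun x => ?_)
  simp only [mul_assoc]
  rw [integral_const_mul]
  simp_rw [mul_comm (planeWave _ _)]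
  rw [(integral_gaussian_mul_planeWave ht (p x)).2]
  push_cast
  ring

theorem mixKernel_nonneg {r t : ℝ} (ht : 0 < t) : 0 ≤ mixKernel d c r t := by
  unfold mixKernel; positivity

theorem measurable_mixKernel : Measurable (fun z : E d × ℝ => mixKernel d c ‖z.1‖ z.2) := by
  unfold mixKernel
  fun_prop

/-- The generalized Fourier transform of the multiquadric, tested against a complex measure
`w dμ`, transported to `ℝ^d` by `p`, that annihilates constants: subtracting the constant makes
the mixture `√s = (2√π)⁻¹ ∫ (1 - exp(-st)) t^(-3/2) dt` a mixture of Gaussians, and the Gaussians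
are transformed one by one. -/
theorem integral_mul_multiquadric (hd : 0 < d) (hc : 0 < c) (hp : Measurable p)
    (hw : Integrable w μ)
    (hwφ : Integrable (fun x => w x * ((multiquadric c ‖p x‖ : ℝ) : ℂ)) μ) (h0 : ∫ x, w x ∂μ = 0)
    (hint : Integrable (fun ξ : E d => (∫ x, w x * planeWave (p x) ξ ∂μ) *
      ((negHat d c ‖ξ‖ : ℝ) : ℂ))) :
    ∫ x, w x * ((multiquadric c ‖p x‖ : ℝ) : ℂ) ∂μ =
      -(((2 * Real.pi) ^ (-(d : ℝ)) : ℝ) : ℂ) * ∫ ξ : E d, (∫ x, w x * planeWave (p x) ξ ∂μ) *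
      ((negHat d c ‖ξ‖ : ℝ) : ℂ) := by
  have : Nonempty (Fin d) := ⟨⟨0, hd⟩⟩
  set u : E d → ℂ := fun ξ => ∫ x, w x * planeWave (p x) ξ ∂μ with hu
  have hs : ∀ x, 0 < ‖p x‖ ^ 2 + c ^ 2 := fun x => by positivity
  set K : X → ℝ → ℝ := fun x t => (1 - Real.exp (-((‖p x‖ ^ 2 + c ^ 2) * t))) * t ^ (-3 / 2 : ℝ)
    with hK
  have hKnn : ∀ x, ∀ t ∈ Ioi (0 : ℝ), 0 ≤ K x t := fun x t ht => by
    have : Real.exp (-((‖p x‖ ^ 2 + c ^ 2) * t)) ≤ 1 :=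
      Real.exp_le_one_iff.2 (neg_nonpos.2 (mul_nonneg (hs x).le (le_of_lt ht)))
    exact mul_nonneg (by linarith) (Real.rpow_nonneg (le_of_lt ht) _)
  have hKmeas : Measurable (fun z : X × ℝ => K z.1 z.2) := by
    simp only [hK]; fun_prop
  have hKint : ∀ x, ∫ t in Ioi (0 : ℝ), K x t = 2 * Real.sqrt Real.pi * multiquadric c ‖p x‖ :=
    fun x => (integral_one_sub_exp_mul_rpow (hs x)).2
  have hprod : Integrable (fun z : X × ℝ => w z.1 * ((K z.1 z.2 : ℝ) : ℂ))
      (μ.prod (volume.restrict (Ioi 0))) := by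
    have hm : AEStronglyMeasurable (fun z : X × ℝ => w z.1 * ((K z.1 z.2 : ℝ) : ℂ))
        (μ.prod (volume.restrict (Ioi 0))) := hw.aestronglyMeasurable.comp_fst.mul
      (Complex.measurable_ofReal.comp hKmeas).aestronglyMeasurable
    rw [integrable_prod_iff hm]
    refine ⟨Eventually.of_forall fun x =>
      ((integral_one_sub_exp_mul_rpow (hs x)).1.ofReal).const_mul (w x), ?_⟩
    refine (hwφ.norm.const_mul (2 * Real.sqrt Real.pi)).congr (Eventually.of_forall fun x => ?_)
    have : ∫ t in Ioi (0 : ℝ), ‖w x * ((K x t : ℝ) : ℂ)‖ = ∫ t in Ioi (0 : ℝ), ‖w x‖ * K x t := by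
      refine setIntegral_congr_fun measurableSet_Ioi fun t ht => ?_
      simp only [norm_mul, Complex.norm_real, Real.norm_of_nonneg (hKnn x t ht)]
    simp only
    rw [this, integral_const_mul, hKint, norm_mul, Complex.norm_real, Real.norm_of_nonneg
      (show 0 ≤ multiquadric c ‖p x‖ from Real.sqrt_nonneg _)]
    ring
  have hswap := integral_integral_swap (f := fun x t => w x * ((K x t : ℝ) : ℂ)) hprod
  have hL : ∫ x, (∫ t in Ioi (0 : ℝ), w x * ((K x t : ℝ) : ℂ)) ∂μ =
      ((2 * Real.sqrt Real.pi : ℝ) : ℂ) * ∫ x, w x * ((multiquadric c ‖p x‖ : ℝ) : ℂ) ∂μ := by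
    rw [← integral_const_mul]
    refine integral_congr_ae (Eventually.of_forall fun x => ?_)
    simp only
    rw [integral_const_mul, integral_complex_ofReal, hKint]
    push_cast
    ring
  have humeas : AEStronglyMeasurable u volume := by
    have hm : Measurable (fun z : E d × X => planeWave (p z.2) z.1) :=
      measurable_planeWave (hp.comp measurable_snd) measurable_fst
    exact AEStronglyMeasurable.integral_prod_right'
      (f := fun z : E d × X => w z.2 * planeWave (p z.2) z.1)
      (hw.aestronglyMeasurable.comp_snd.mul hm.aestronglyMeasurable)
  -- The part of the kernel that is constant in `x` is annihilated by `w`.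
  have hR : ∀ t ∈ Ioi (0 : ℝ), ∫ x, w x * ((K x t : ℝ) : ℂ) ∂μ =
      -(((4 * Real.pi) ^ (-(d : ℝ) / 2) : ℝ) : ℂ) *
        ∫ ξ : E d, u ξ * ((mixKernel d c ‖ξ‖ t : ℝ) : ℂ) := by
    intro t ht
    have ht : 0 < t := ht
    have hwg : Integrable (fun x => w x * ((Real.exp (-(t * ‖p x‖ ^ 2)) : ℝ) : ℂ)) μ := by
      refine hw.mul_bdd (c := 1) (by
        exact (by fun_prop : Measurable fun x => ((Real.exp
            (-(t * ‖p x‖ ^ 2)) : ℝ) : ℂ)).aestronglyMeasurable)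
        (Eventually.of_forall fun x => ?_)
      rw [Complex.norm_real, Real.norm_of_nonneg (Real.exp_pos _).le, Real.exp_le_one_iff]
      simpa using mul_nonneg ht.le (sq_nonneg _)
    have h1 : ∀ x, w x * ((K x t : ℝ) : ℂ) = ((t ^ (-3 / 2 : ℝ) : ℝ) : ℂ) * w x -
        ((t ^ (-3 / 2 : ℝ) * Real.exp (-(t * c ^ 2)) : ℝ) : ℂ) *
          (w x * ((Real.exp (-(t * ‖p x‖ ^ 2)) : ℝ) : ℂ)) := fun x => by
      have : Real.exp (-((‖p x‖ ^ 2 + c ^ 2) * t)) =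
          Real.exp (-(t * c ^ 2)) * Real.exp (-(t * ‖p x‖ ^ 2)) := by
        rw [← Real.exp_add]; ring_nf
      simp only [hK, this]
      push_cast
      ring
    simp_rw [h1]
    rw [integral_sub (hw.const_mul _) (hwg.const_mul _), integral_const_mul, integral_const_mul, h0]
    have h2 := integral_mul_gaussian hp hw ht
    have h3 : ∫ ξ : E d, u ξ * ((mixKernel d c ‖ξ‖ t : ℝ) : ℂ) =
        ((t ^ (-((d : ℝ) + 3) / 2) * Real.exp (-(t * c ^ 2)) : ℝ) : ℂ) *
          ∫ ξ : E d, u ξ * ((Real.exp (-(‖ξ‖ ^ 2 / (4 * t))) : ℝ) : ℂ) := by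
      rw [← integral_const_mul]
      refine integral_congr_ae (Eventually.of_forall fun ξ => ?_)
      simp only [mixKernel, neg_add, Real.exp_add]
      push_cast
      ring
    rw [h3, h2, ← mul_assoc, ← mul_assoc, mul_zero, zero_sub, ← neg_mul]
    congr 1
    simp only [← Complex.ofReal_mul, ← Complex.ofReal_neg]
    refine congrArg _ ?_
    rw [Real.mul_rpow (by positivity) ht.le]
    have e1 : (4 * Real.pi) ^ (-(d : ℝ) / 2) * (4 * Real.pi) ^ ((d : ℝ) / 2) = 1 := by
      rw [← Real.rpow_add (by positivity), neg_div, neg_add_cancel, Real.rpow_zero]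
    have e2 : t ^ (-((d : ℝ) + 3) / 2) * t ^ ((d : ℝ) / 2) = t ^ (-3 / 2 : ℝ) := by
      rw [← Real.rpow_add ht]; congr 1; ring
    linear_combination Real.exp (-(t * c ^ 2)) * e2 + Real.exp (-(t * c ^ 2)) *
      t ^ (-((d : ℝ) + 3) / 2) * t ^ ((d : ℝ) / 2) * e1
  have hprod2 : Integrable (fun z : E d × ℝ => u z.1 * ((mixKernel d c ‖z.1‖ z.2 : ℝ) : ℂ))
      (volume.prod (volume.restrict (Ioi 0))) := by
    have hm : AEStronglyMeasurable (fun z : E d × ℝ => u z.1 * ((mixKernel d c ‖z.1‖ z.2 : ℝ) : ℂ))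
        (volume.prod (volume.restrict (Ioi 0))) := humeas.comp_fst.mul
      (Complex.measurable_ofReal.comp measurable_mixKernel).aestronglyMeasurable
    rw [integrable_prod_iff hm]
    have hne : ∀ᵐ ξ : E d, ξ ≠ 0 := by
      simp [ae_iff]
    constructor
    · filter_upwards [hne] with ξ hξ
      exact ((integral_mixKernel d hc (norm_pos_iff.2 hξ)).1.ofReal).const_mul _
    · refine (hint.norm.const_mul (2 * Real.pi ^ ((1 - (d : ℝ)) / 2))).congr ?_
      filter_upwards [hne] with ξ hξ
      have : ∫ t in Ioi (0 : ℝ), ‖u ξ * ((mixKernel d c ‖ξ‖ t : ℝ) : ℂ)‖ =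
          ∫ t in Ioi (0 : ℝ), ‖u ξ‖ * mixKernel d c ‖ξ‖ t := by
        refine setIntegral_congr_fun measurableSet_Ioi fun t ht => ?_
        simp only [norm_mul, Complex.norm_real, Real.norm_of_nonneg (mixKernel_nonneg ht)]
      rw [this, integral_const_mul, (integral_mixKernel d hc (norm_pos_iff.2 hξ)).2, norm_mul,
        Complex.norm_real, Real.norm_of_nonneg (negHat_nonneg hc (norm_nonneg _))]
      ring
  have hswap2 := integral_integral_swap
    (f := fun ξ t => u ξ * ((mixKernel d c ‖ξ‖ t : ℝ) : ℂ)) hprod2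
  have hM : ∫ ξ : E d, ∫ t in Ioi (0 : ℝ), u ξ * ((mixKernel d c ‖ξ‖ t : ℝ) : ℂ) =
      ((2 * Real.pi ^ ((1 - (d : ℝ)) / 2) : ℝ) : ℂ) * ∫ ξ : E d,
          u ξ * ((negHat d c ‖ξ‖ : ℝ) : ℂ) := by
    rw [← integral_const_mul]
    refine integral_congr_ae ?_
    have hne : ∀ᵐ ξ : E d, ξ ≠ 0 := by
      simp [ae_iff]
    filter_upwards [hne] with ξ hξ
    rw [integral_const_mul, integral_complex_ofReal,
      (integral_mixKernel d hc (norm_pos_iff.2 hξ)).2]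
    push_cast
    ring
  rw [hL, setIntegral_congr_fun measurableSet_Ioi hR, integral_const_mul, ← hswap2, hM] at hswap
  have hsq : ((2 * Real.sqrt Real.pi : ℝ) : ℂ) ≠ 0 := by
    have := Real.sqrt_pos.2 Real.pi_pos
    exact_mod_cast (by positivity : (2 * Real.sqrt Real.pi) ≠ 0)
  refine mul_left_cancel₀ hsq (hswap.trans ?_)
  rw [← mul_assoc, ← mul_assoc]
  congr 1
  simp only [← Complex.ofReal_mul, ← Complex.ofReal_neg]
  refine congrArg _ ?_
  rw [neg_mul, mul_neg, neg_inj]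
  have e1 : (4 * Real.pi) ^ (-(d : ℝ) / 2) = (2 : ℝ) ^ (-(d : ℝ)) * Real.pi ^ (-(d : ℝ) / 2) := by
    rw [Real.mul_rpow (by norm_num) Real.pi_pos.le, show (4 : ℝ) = 2 ^ (2 : ℝ) by norm_num,
      ← Real.rpow_mul (by norm_num)]
    ring_nf
  have e2 : Real.pi ^ (-(d : ℝ) / 2) * Real.pi ^ ((1 - (d : ℝ)) / 2) =
      Real.sqrt Real.pi * Real.pi ^ (-(d : ℝ)) := by
    rw [Real.sqrt_eq_rpow, ← Real.rpow_add Real.pi_pos, ← Real.rpow_add Real.pi_pos]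
    ring_nf
  rw [e1, Real.mul_rpow (by norm_num) Real.pi_pos.le]
  linear_combination (2 * (2 : ℝ) ^ (-(d : ℝ))) * e2

end Mixture

/-! ### Periodization and uniqueness of Fourier coefficients -/

/-- The half-open unit cube `(0, 1]^d`. -/
def unitCube (d : ℕ) : Set (Fin d → ℝ) := {x | ∀ i, x i ∈ Ioc (0 : ℝ) 1}

/-- An integer vector, as a real vector. -/
def intVec (k : Fin d → ℤ) : Fin d → ℝ := fun i => (k i : ℝ)

theorem measurableSet_unitCube : MeasurableSet (unitCube d) :=
  MeasurableSet.univ_pi' fun _ => measurableSet_Ioc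

theorem exists_add_intVec_mem_unitCube (x : Fin d → ℝ) : ∃ k, x + intVec k ∈ unitCube d := by
  refine ⟨fun i => 1 - ⌈x i⌉, fun i => ?_⟩
  simp only [Pi.add_apply, intVec]
  push_cast
  constructor <;> linarith [Int.le_ceil (x i), Int.ceil_lt_add_one (x i)]

theorem iUnion_preimage_unitCube :
    ⋃ k : Fin d → ℤ, (fun x => x + intVec k) ⁻¹' unitCube d = univ :=
  eq_univ_of_forall fun x => mem_iUnion.2 (exists_add_intVec_mem_unitCube x)

theorem pairwise_disjoint_preimage_unitCube :
    Pairwise (Function.onFun Disjoint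
      fun k : Fin d → ℤ => (fun x => x + intVec k) ⁻¹' unitCube d) := by
  intro k l hkl
  refine disjoint_left.2 fun x hk hl => hkl (funext fun i => ?_)
  have h1 := hk i
  have h2 := hl i
  simp only [Pi.add_apply, intVec, mem_Ioc] at h1 h2
  have h3 : (k i : ℝ) < l i + 1 := by linarith
  have h4 : (l i : ℝ) < k i + 1 := by linarith
  norm_cast at h3 h4
  lia

section Unfolding

variable {V : Type*} [NormedAddCommGroup V] {f : (Fin d → ℝ) → V}

theorem integrableOn_add_intVec (hf : Integrable f) (k : Fin d → ℤ) :
    IntegrableOn (fun x => f (x + intVec k)) (unitCube d) :=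
  (hf.comp_add_right _).integrableOn

theorem setIntegral_add_intVec [NormedSpace ℝ V] (k : Fin d → ℤ) (f : (Fin d → ℝ) → V) :
    ∫ x in (fun x => x + intVec (-k)) ⁻¹' unitCube d, f x = ∫ x in unitCube d, f (x + intVec k) :=
        by
  have h := (measurePreserving_add_right (volume : Measure (Fin d → ℝ))
    (intVec (-k))).setIntegral_preimage_emb (measurableEmbedding_addRight _)
    (fun x => f (x + intVec k)) (unitCube d)
  rw [← h]
  congr 1
  ext x
  congr 1
  ext i
  simp [intVec]

theorem hasSum_setIntegral_add_intVec [NormedSpace ℝ V] (hf : Integrable f) :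
    HasSum (fun k : Fin d → ℤ => ∫ x in unitCube d, f (x + intVec k)) (∫ x, f x) := by
  have h := hasSum_integral_iUnion (f := f) (μ := volume)
    (s := fun k : Fin d → ℤ => (fun x => x + intVec k) ⁻¹' unitCube d)
    (fun k => measurableSet_unitCube.preimage (measurable_id.add_const _))
    pairwise_disjoint_preimage_unitCube hf.integrableOn
  rw [iUnion_preimage_unitCube, setIntegral_univ, ← (Equiv.neg (Fin d → ℤ)).hasSum_iff] at h
  refine h.congr_fun fun k => ?_
  exact (setIntegral_add_intVec k f).symm

/-- The unfolding identity: the integral over `ℝ^d` is the integral of the periodization over the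
unit cube. -/
theorem integral_eq_setIntegral_tsum_add_intVec [NormedSpace ℝ V] (hf : Integrable f) :
    ∫ x, f x = ∫ x in unitCube d, ∑' k : Fin d → ℤ, f (x + intVec k) :=
  (hasSum_setIntegral_add_intVec hf).unique
    (hasSum_integral_of_summable_integral_norm (fun k => integrableOn_add_intVec hf k)
      (hasSum_setIntegral_add_intVec hf.norm).summable)

theorem integrableOn_tsum_add_intVec [CompleteSpace V] (hf : Integrable f) :
    IntegrableOn (fun x => ∑' k : Fin d → ℤ, f (x + intVec k)) (unitCube d) := by
  have hs := (hasSum_setIntegral_add_intVec hf.norm).summable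
  have hfin : ∫⁻ x in unitCube d, ∑' k : Fin d → ℤ, ‖f (x + intVec k)‖ₑ < ⊤ := by
    rw [lintegral_tsum fun k => (integrableOn_add_intVec hf k).aestronglyMeasurable.enorm]
    have : ∀ k : Fin d → ℤ, ∫⁻ x in unitCube d, ‖f (x + intVec k)‖ₑ =
        ENNReal.ofReal (∫ x in unitCube d, ‖f (x + intVec k)‖) := fun k =>
      (ofReal_integral_norm_eq_lintegral_enorm (integrableOn_add_intVec hf k)).symm
    simp_rw [this]
    rw [← ENNReal.ofReal_tsum_of_nonneg (fun k => integral_nonneg fun x => norm_nonneg _) hs]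
    exact ENNReal.ofReal_lt_top
  have hae : ∀ᵐ x ∂(volume.restrict (unitCube d)),
      HasSum (fun k : Fin d → ℤ => f (x + intVec k)) (∑' k : Fin d → ℤ, f (x + intVec k)) := by
    filter_upwards [ae_lt_top' (AEMeasurable.tsum fun k =>
      (integrableOn_add_intVec hf k).aestronglyMeasurable.enorm) hfin.ne] with x hx
    refine Summable.hasSum (Summable.of_enorm hx.ne)
  refine ⟨aestronglyMeasurable_of_tendsto_ae (atTop : Filter (Finset (Fin d → ℤ)))
    (f := fun s x => ∑ k ∈ s, f (x + intVec k)) (fun s =>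
      Finset.aestronglyMeasurable_fun_sum _ fun k _ =>
          (integrableOn_add_intVec hf k).aestronglyMeasurable)
      hae, ?_⟩
  refine lt_of_le_of_lt (lintegral_mono fun x => ?_) hfin
  exact enorm_tsum_le_tsum_enorm

end Unfolding

/-- The projection of `ℝ^d` onto the torus `ℝ^d / ℤ^d`. -/
def toTorus (x : Fin d → ℝ) : UnitAddTorus (Fin d) := fun i => (x i : UnitAddCircle)

theorem measurable_toTorus : Measurable (toTorus (d := d)) :=
  measurable_pi_lambda _ fun i => AddCircle.measurable_mk'.comp (measurable_pi_apply i)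

theorem toTorus_add_intVec (x : Fin d → ℝ) (k : Fin d → ℤ) :
    toTorus (x + intVec k) = toTorus x := by
  funext i
  simp [toTorus, intVec]

/-- If the Fourier transform of an integrable function vanishes on the lattice, so does its
integral against every continuous periodic function. -/
theorem integral_mul_comp_toTorus_eq_zero {F : (Fin d → ℝ) → ℂ} (hF : Integrable F)
    (h : ∀ n : Fin d → ℤ, ∫ x, UnitAddTorus.mFourier n (toTorus x) * F x = 0)
    (P : C(UnitAddTorus (Fin d), ℂ)) : ∫ x, P (toTorus x) * F x = 0 := by
  have hP : ∀ P : C(UnitAddTorus (Fin d), ℂ), Integrable (fun x => P (toTorus x) * F x) := fun P =>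
    hF.bdd_mul (c := ‖P‖) (P.continuous.measurable.comp measurable_toTorus).aestronglyMeasurable
      (Eventually.of_forall fun x => P.norm_coe_le_norm _)
  let Λ : C(UnitAddTorus (Fin d), ℂ) →ₗ[ℂ] ℂ :=
    { toFun := fun P => ∫ x, P (toTorus x) * F x
      map_add' := fun P Q => by
        rw [← integral_add (hP P) (hP Q)]
        simp [add_mul]
      map_smul' := fun a P => by
        simp only [ContinuousMap.coe_smul, Pi.smul_apply, smul_eq_mul, mul_assoc, RingHom.id_apply]
        rw [integral_const_mul] }
  let Λc := Λ.mkContinuous (∫ x, ‖F x‖) fun P => by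
    refine (norm_integral_le_integral_norm _).trans ?_
    rw [← integral_mul_const]
    refine integral_mono (hP P).norm (hF.norm.mul_const _) fun x => ?_
    simp only [norm_mul]
    rw [mul_comm]
    exact mul_le_mul_of_nonneg_left (P.norm_coe_le_norm _) (norm_nonneg _)
  have hker : (Submodule.span ℂ (range (UnitAddTorus.mFourier (d := Fin d)))).topologicalClosure ≤
      LinearMap.ker (Λc : C(UnitAddTorus (Fin d), ℂ) →ₗ[ℂ] ℂ) := by
    refine Submodule.topologicalClosure_minimal _ (Submodule.span_le.2 ?_) Λc.isClosed_ker
    rintro _ ⟨n, rfl⟩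
    exact h n
  rw [UnitAddTorus.span_mFourier_closure_eq_top] at hker
  exact hker (Submodule.mem_top (x := P))

/-- If the Fourier transform of an integrable function vanishes on the lattice, then so does its
periodization. -/
theorem ae_tsum_add_intVec_eq_zero {F : (Fin d → ℝ) → ℂ} (hF : Integrable F)
    (h : ∀ n : Fin d → ℤ, ∫ x, UnitAddTorus.mFourier n (toTorus x) * F x = 0) :
    ∀ᵐ x, ∑' k : Fin d → ℤ, F (x + intVec k) = 0 := by
  set G : (Fin d → ℝ) → ℂ := fun x => ∑' k : Fin d → ℤ, F (x + intVec k) with hG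
  have hGper : ∀ x l, G (x + intVec l) = G x := fun x l => by
    simp only [hG]
    rw [← (Equiv.addLeft l).tsum_eq (fun k => F (x + intVec k))]
    refine tsum_congr fun k => congrArg F ?_
    ext i
    simp [intVec, add_assoc]
  -- A measurable section of the projection onto the torus.
  set s : UnitAddTorus (Fin d) → (Fin d → ℝ) :=
    fun y => (UnitAddTorus.measurableEquivPiIoc (fun _ => (0 : ℝ)) y).1 with hs
  have hsm : Measurable s := measurable_subtype_coe.comp (MeasurableEquiv.measurable _)
  have hsec : ∀ x ∈ unitCube d, s (toTorus x) = x := fun x hx => by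
    funext i
    have hxi : x i ∈ Ioc (0 : ℝ) (0 + 1) := by simpa using hx i
    simp only [hs, UnitAddTorus.coe_measurableEquivPiIoc_apply, toTorus]
    rw [AddCircle.equivIoc_coe_eq hxi]
  set ν := (volume.restrict (unitCube d)).map toTorus with hν
  have hcongr : (fun x => G (s (toTorus x))) =ᵐ[volume.restrict (unitCube d)] G := by
    filter_upwards [ae_restrict_mem measurableSet_unitCube] with x hx
    rw [hsec x hx]
  have hGint : IntegrableOn G (unitCube d) := integrableOn_tsum_add_intVec hF
  have hGs : AEStronglyMeasurable (G ∘ s) ν := by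
    have hmap : ν.map s = volume.restrict (unitCube d) := by
      rw [hν, Measure.map_map hsm measurable_toTorus]
      have : (s ∘ toTorus) =ᵐ[volume.restrict (unitCube d)] id := by
        filter_upwards [ae_restrict_mem measurableSet_unitCube] with x hx
        exact hsec x hx
      rw [Measure.map_congr this, Measure.map_id]
    refine AEStronglyMeasurable.comp_measurable ?_ hsm
    rw [hmap]
    exact hGint.aestronglyMeasurable
  have hGsi : Integrable (G ∘ s) ν := by
    rw [hν, integrable_map_measure hGs measurable_toTorus.aemeasurable]
    exact hGint.congr hcongr.symm
  have hzero : (G ∘ s) =ᵐ[ν] 0 := by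
    refine ae_eq_zero_of_forall_setIntegral_isClosed_eq_zero hGsi fun Z hZ => ?_
    -- By unfolding, this is an integral of `F`; approximate the indicator of `Z` by continuous
    -- functions.
    have h1 : ∫ y in Z, (G ∘ s) y ∂ν = ∫ x, (toTorus ⁻¹' Z).indicator F x := by
      have hZm : MeasurableSet (toTorus ⁻¹' Z) := measurable_toTorus hZ.measurableSet
      rw [← integral_indicator hZ.measurableSet, hν, integral_map measurable_toTorus.aemeasurable
        (hGs.indicator hZ.measurableSet),
        integral_eq_setIntegral_tsum_add_intVec (hF.indicator hZm)]
      refine setIntegral_congr_fun measurableSet_unitCube fun x hx => ?_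
      have hmem : ∀ k, x + intVec k ∈ toTorus ⁻¹' Z ↔ toTorus x ∈ Z := fun k => by
        rw [mem_preimage, toTorus_add_intVec]
      by_cases hxZ : toTorus x ∈ Z
      · simp only [indicator, hmem, hxZ, if_true, Function.comp_apply, hsec x hx, hG]
      · simp only [indicator, hmem, hxZ, if_false, tsum_zero]
    rw [h1]
    have hlim := tendsto_integral_of_dominated_convergence (μ := volume)
      (F := fun n x => ((hZ.apprSeq n (toTorus x) : ℝ) : ℂ) * F x)
      (f := (toTorus ⁻¹' Z).indicator F) (fun x => ‖F x‖) (fun n => ?_) hF.norm (fun n => ?_) ?_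
    · refine tendsto_nhds_unique hlim ?_
      have : ∀ n, ∫ x, ((hZ.apprSeq n (toTorus x) : ℝ) : ℂ) * F x = 0 := fun n =>
        integral_mul_comp_toTorus_eq_zero hF h
          ⟨fun y => ((hZ.apprSeq n y : ℝ) : ℂ), by fun_prop⟩
      simp [this]
    · refine AEStronglyMeasurable.mul ?_ hF.aestronglyMeasurable
      have hm : Measurable fun y => ((hZ.apprSeq n y : ℝ) : ℂ) :=
        (by fun_prop : Continuous fun y => ((hZ.apprSeq n y : ℝ) : ℂ)).measurable
      exact (hm.comp measurable_toTorus).aestronglyMeasurable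
    · refine Eventually.of_forall fun x => ?_
      rw [norm_mul, Complex.norm_real, Real.norm_of_nonneg (NNReal.coe_nonneg _)]
      refine mul_le_of_le_one_left (norm_nonneg _) ?_
      exact_mod_cast HasOuterApproxClosed.apprSeq_apply_le_one hZ n (toTorus x)
    · refine Eventually.of_forall fun x => ?_
      have h2 := (tendsto_pi_nhds.1 (HasOuterApproxClosed.tendsto_apprSeq hZ)) (toTorus x)
      have h3 : Tendsto (fun n => ((hZ.apprSeq n (toTorus x) : ℝ) : ℂ)) atTop
          (𝓝 (((Z.indicator (fun _ => (1 : NNReal)) (toTorus x) : NNReal) : ℝ) : ℂ)) :=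
        (Complex.continuous_ofReal.tendsto _).comp ((NNReal.continuous_coe.tendsto _).comp h2)
      convert h3.mul_const (F x) using 2
      by_cases hxZ : toTorus x ∈ Z <;> simp [indicator, hxZ]
  have hcube : ∀ᵐ x ∂(volume.restrict (unitCube d)), G x = 0 := by
    have := ae_of_ae_map measurable_toTorus.aemeasurable hzero
    filter_upwards [this, hcongr] with x h1 h2
    rw [← h2]; exact h1
  rw [ae_restrict_iff' measurableSet_unitCube] at hcube
  have hall : ∀ᵐ x : Fin d → ℝ, ∀ k : Fin d → ℤ, x + intVec k ∈ unitCube d → G (x + intVec k) = 0 :=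
    ae_all_iff.2 fun k =>
      (measurePreserving_add_right (volume : Measure (Fin d →
          ℝ)) (intVec k)).quasiMeasurePreserving.ae hcube
  filter_upwards [hall] with x hx
  obtain ⟨k, hk⟩ := exists_add_intVec_mem_unitCube x
  exact (hGper x k).symm.trans (hx k hk)

/-! ### Lattice periodization in Euclidean space -/

theorem mFourier_toTorus (n : Fin d → ℤ) (x : Fin d → ℝ) :
    UnitAddTorus.mFourier n (toTorus x) = planeWave (lat n) ((2 * Real.pi) • WithLp.toLp 2 x) := by
  simp only [UnitAddTorus.mFourier, toTorus, ContinuousMap.coe_mk, fourier_coe_apply, planeWave,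
    ← Complex.exp_sum, lat, inner_smul_right, PiLp.inner_apply, RCLike.inner_apply, conj_trivial]
  congr 1
  push_cast
  rw [Finset.mul_sum, Finset.mul_sum]
  refine Finset.sum_congr rfl fun i _ => ?_
  simp
  ring

/-- The Euclidean form, with period `2π`, of `ae_tsum_add_intVec_eq_zero`. -/
theorem ae_tsum_add_lat_eq_zero {F : E d → ℂ} (hF : Integrable F)
    (h : ∀ n : Fin d → ℤ, ∫ ξ, planeWave (lat n) ξ * F ξ = 0) :
    ∀ᵐ ξ, ∑' k : Fin d → ℤ, F (ξ + (2 * Real.pi) • lat k) = 0 := by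
  have hpi : (2 * Real.pi) ≠ 0 := by positivity
  have hto := PiLp.volume_preserving_toLp (Fin d)
  have hemb : MeasurableEmbedding (WithLp.toLp 2 : (Fin d → ℝ) → E d) :=
    (MeasurableEquiv.toLp 2 _).measurableEmbedding
  have hF' : Integrable (fun x : Fin d → ℝ => F ((2 * Real.pi) • WithLp.toLp 2 x)) :=
    (hto.integrable_comp_emb hemb).2 (hF.comp_smul hpi)
  have key := ae_tsum_add_intVec_eq_zero hF' fun n => by
    simp_rw [mFourier_toTorus]
    rw [hto.integral_comp hemb (fun ξ => planeWave (lat n) ((2 * Real.pi) • ξ) *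
      F ((2 * Real.pi) • ξ)),
      Measure.integral_comp_smul volume (fun ξ => planeWave (lat n) ξ * F ξ), h n, smul_zero]
  have hof : Measure.QuasiMeasurePreserving (WithLp.ofLp : E d → Fin d → ℝ) volume volume :=
    (PiLp.volume_preserving_ofLp (Fin d)).quasiMeasurePreserving
  have hq := hof.comp (Measure.quasiMeasurePreserving_smul (volume : Measure (E d))
    (inv_ne_zero hpi))
  filter_upwards [hq.ae key] with ξ hξ
  rw [← hξ]
  refine tsum_congr fun k => congrArg F ?_
  ext i
  simp [lat, intVec]
  field_simp

/-! ### Lattice sums -/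

theorem add_lat_apply (ξ : E d) (k : Fin d → ℤ) (i : Fin d) :
    (ξ + (2 * Real.pi) • lat k) i = ξ i + 2 * Real.pi * k i := by
  simp [lat]

theorem abs_apply_le_norm (v : E d) (i : Fin d) : |v i| ≤ ‖v‖ := by
  simpa using PiLp.norm_apply_le v i

theorem norm_le_sum_abs (v : E d) : ‖v‖ ≤ ∑ i, |v i| := by
  rw [EuclideanSpace.norm_eq]
  refine Real.sqrt_le_iff.2 ⟨Finset.sum_nonneg fun i _ => abs_nonneg _, ?_⟩
  simpa using Finset.sum_sq_le_sq_sum_of_nonneg (s := Finset.univ) (f := fun i => |v i|)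
    fun i _ => abs_nonneg _

theorem summable_prod_of_summable {f : ℤ → ℝ} (hf : Summable f) (h0 : ∀ j, 0 ≤ f j) :
    ∀ d : ℕ, Summable (fun k : Fin d → ℤ => ∏ i, f (k i))
  | 0 => (hasSum_fintype _).summable
  | d + 1 => by
    rw [← (Fin.consEquiv fun _ : Fin (d + 1) => ℤ).summable_iff]
    refine (hf.mul_of_nonneg (summable_prod_of_summable hf h0 d) h0 fun k =>
      Finset.prod_nonneg fun i _ => h0 _).congr fun z => ?_
    simp [Fin.consEquiv, Fin.prod_univ_succ]

theorem summable_exp_neg_abs_int {β : ℝ} (hβ : 0 < β) :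
    Summable (fun j : ℤ => Real.exp (-(β * |(j : ℝ)|))) := by
  have h : Summable (fun n : ℕ => Real.exp (-(β * (n : ℝ)))) := by
    refine (Real.summable_exp_nat_mul_iff.2 (neg_neg_of_pos hβ)).congr fun n => ?_
    ring_nf
  refine Summable.of_nat_of_neg ?_ ?_ <;> simpa using h

theorem summable_exp_neg_norm_add_lat {α : ℝ} (hα : 0 < α) (ξ : E d) :
    Summable (fun k : Fin d → ℤ => Real.exp (-(α * ‖ξ + (2 * Real.pi) • lat k‖))) := by
  rcases Nat.eq_zero_or_pos d with rfl | hd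
  · exact (hasSum_fintype _).summable
  have hβ : 0 < α / d := by positivity
  refine Summable.of_nonneg_of_le (fun k => (Real.exp_pos _).le) (fun k => ?_)
    ((summable_prod_of_summable (summable_exp_neg_abs_int hβ) (fun j =>
        (Real.exp_pos _).le) d).mul_left
      (Real.exp (α * ‖ξ‖)))
  rw [← Real.exp_sum, ← Real.exp_add, Real.exp_le_exp]
  have h1 : ∀ i, |(k i : ℝ)| ≤ ‖ξ + (2 * Real.pi) • lat k‖ + ‖ξ‖ := fun i => by
    have h2 := abs_apply_le_norm (ξ + (2 * Real.pi) • lat k) i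
    have h3 := abs_apply_le_norm ξ i
    rw [add_lat_apply] at h2
    have h4 : |2 * Real.pi * (k i : ℝ)| ≤ |ξ i + 2 * Real.pi * k i| + |ξ i| := by
      simpa using abs_sub (ξ i + 2 * Real.pi * k i) (ξ i)
    rw [abs_mul, abs_of_pos Real.two_pi_pos] at h4
    nlinarith [abs_nonneg (k i : ℝ), Real.pi_gt_three]
  have h2 : ∑ i, |(k i : ℝ)| ≤ d * (‖ξ + (2 * Real.pi) • lat k‖ + ‖ξ‖) := by
    simpa [mul_add] using Finset.sum_le_sum fun i (_ : i ∈ Finset.univ) => h1 i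
  have h3 : ∑ i, -(α / d * |(k i : ℝ)|) = -(α / d * ∑ i, |(k i : ℝ)|) := by
    rw [Finset.mul_sum, Finset.sum_neg_distrib]
  rw [h3]
  have h4 := mul_le_mul_of_nonneg_left h2 hβ.le
  have h5 : α / d * (d * (‖ξ + (2 * Real.pi) • lat k‖ + ‖ξ‖)) =
      α * (‖ξ + (2 * Real.pi) • lat k‖ + ‖ξ‖) := by
    have : (d : ℝ) ≠ 0 := by positivity
    field_simp
  linarith

/-- The lattice translate of a point into the cube `[-π, π]^d`. -/
theorem exists_add_lat_le_pi (ξ : E d) :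
    ∃ k : Fin d → ℤ, ∀ i, |(ξ + (2 * Real.pi) • lat k) i| ≤ Real.pi := by
  refine ⟨fun i => -round (ξ i / (2 * Real.pi)), fun i => ?_⟩
  rw [add_lat_apply]
  have h := abs_sub_round (ξ i / (2 * Real.pi))
  have h2 : ξ i + 2 * Real.pi * ((-round (ξ i / (2 * Real.pi)) : ℤ) : ℝ) =
      2 * Real.pi * (ξ i / (2 * Real.pi) - round (ξ i / (2 * Real.pi))) := by
    push_cast
    field_simp
    ring
  rw [h2, abs_mul, abs_of_pos Real.two_pi_pos]
  nlinarith [Real.pi_pos]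

/-- Near every point all lattice translates but one stay away from the origin. -/
theorem one_le_norm_add_lat {ξ₀ ξ : E d} {k₀ k : Fin d → ℤ}
    (hk₀ : ∀ i, |(ξ₀ + (2 * Real.pi) • lat k₀) i| ≤ Real.pi) (hξ : ξ ∈ Metric.ball ξ₀ 1)
    (hk : k ≠ k₀) : 1 ≤ ‖ξ + (2 * Real.pi) • lat k‖ := by
  obtain ⟨i, hi⟩ := Function.ne_iff.1 hk
  refine le_trans ?_ (abs_apply_le_norm _ i)
  have h1 := hk₀ i
  rw [add_lat_apply] at h1 ⊢
  have h2 : |(ξ - ξ₀) i| < 1 := (abs_apply_le_norm _ i).trans_lt (by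
    rwa [← dist_eq_norm])
  have h3 : (1 : ℝ) ≤ |(k i : ℝ) - k₀ i| := by
    exact_mod_cast Int.one_le_abs (sub_ne_zero.2 hi)
  have h4 : 2 * Real.pi * ((k i : ℝ) - k₀ i) = (ξ i + 2 * Real.pi * k i) -
      (ξ₀ i + 2 * Real.pi * k₀ i) - (ξ - ξ₀) i := by
    simp; ring
  have h5 : |2 * Real.pi * ((k i : ℝ) - k₀ i)| ≤ |ξ i + 2 * Real.pi * k i| +
      |ξ₀ i + 2 * Real.pi * k₀ i| + |(ξ - ξ₀) i| := by
    rw [h4]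
    exact (abs_sub _ _).trans (add_le_add_left (abs_sub _ _) _)
  rw [abs_mul, abs_of_pos Real.two_pi_pos] at h5
  nlinarith [Real.pi_gt_three]

theorem negHat_le_of_one_le (hc : 0 < c) {r : ℝ} (hr : 1 ≤ r) :
    negHat d c r ≤ Real.exp c * negHat d c 1 * Real.exp (-(c * r)) := by
  refine (negHat_le_exp_mul hc one_pos hr).trans (le_of_eq ?_)
  rw [mul_right_comm, ← Real.exp_add]
  ring_nf

/-- The lattice sum without its `k₀`-th term. -/
def tailSum (d : ℕ) (c : ℝ) (k₀ : Fin d → ℤ) (ξ : E d) : ℝ :=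
  ∑' k : Fin d → ℤ, if k = k₀ then 0 else negHat d c ‖ξ + (2 * Real.pi) • lat k‖

theorem summable_negHat_add_lat (hc : 0 < c) (ξ : E d) :
    Summable (fun k : Fin d → ℤ => negHat d c ‖ξ + (2 * Real.pi) • lat k‖) := by
  obtain ⟨k₀, hk₀⟩ := exists_add_lat_le_pi ξ
  refine Summable.of_norm_bounded_eventually ((summable_exp_neg_norm_add_lat hc ξ).mul_left
    (Real.exp c * negHat d c 1)) ?_
  filter_upwards [(Set.finite_singleton k₀).compl_mem_cofinite] with k hk
  rw [Real.norm_of_nonneg (negHat_nonneg hc (norm_nonneg _))]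
  exact negHat_le_of_one_le hc (one_le_norm_add_lat hk₀ (Metric.mem_ball_self one_pos) hk)

theorem tsum_negHat_eq (hc : 0 < c) (ξ : E d) (k₀ : Fin d → ℤ) :
    ∑' k : Fin d → ℤ, negHat d c ‖ξ + (2 * Real.pi) • lat k‖ =
      negHat d c ‖ξ + (2 * Real.pi) • lat k₀‖ + tailSum d c k₀ ξ :=
  (summable_negHat_add_lat hc ξ).tsum_eq_add_tsum_ite k₀

theorem tailSum_nonneg (hc : 0 < c) (ξ : E d) (k₀ : Fin d → ℤ) : 0 ≤ tailSum d c k₀ ξ := by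
  refine tsum_nonneg fun k => ?_
  split_ifs
  · exact le_rfl
  · exact negHat_nonneg hc (norm_nonneg _)

theorem continuousOn_tailSum (hc : 0 < c) {ξ₀ : E d} {k₀ : Fin d → ℤ}
    (hk₀ : ∀ i, |(ξ₀ + (2 * Real.pi) • lat k₀) i| ≤ Real.pi) :
    ContinuousOn (tailSum d c k₀) (Metric.ball ξ₀ 1) := by
  refine continuousOn_tsum (u := fun k => Real.exp c * negHat d c 1 *
    (Real.exp c * Real.exp (-(c * ‖ξ₀ + (2 * Real.pi) • lat k‖)))) (fun k => ?_)
    (((summable_exp_neg_norm_add_lat hc ξ₀).mul_left _).mul_left _) fun k ξ hξ => ?_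
  · by_cases hk : k = k₀
    · simp [hk, continuousOn_const]
    · simp only [hk, if_false]
      refine (continuousOn_negHat hc).comp (by fun_prop) fun ξ hξ => ?_
      exact one_pos.trans_le (one_le_norm_add_lat hk₀ hξ hk)
  · have h1 := (negHat_pos (d := d) hc one_pos).le
    by_cases hk : k = k₀
    · simp only [hk, if_true, norm_zero]
      positivity
    · simp only [hk, if_false]
      rw [Real.norm_of_nonneg (negHat_nonneg hc (norm_nonneg _))]
      refine (negHat_le_of_one_le hc (one_le_norm_add_lat hk₀ hξ hk)).trans ?_
      refine mul_le_mul_of_nonneg_left ?_ (by positivity)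
      rw [← Real.exp_add, Real.exp_le_exp]
      have h2 : ‖ξ₀ + (2 * Real.pi) • lat k‖ ≤ ‖ξ + (2 * Real.pi) • lat k‖ + 1 := by
        have h3 := norm_sub_norm_le (ξ₀ + (2 * Real.pi) • lat k) (ξ + (2 * Real.pi) • lat k)
        rw [add_sub_add_right_eq_sub, ← dist_eq_norm] at h3
        have h4 := Metric.mem_ball'.1 hξ
        linarith
      nlinarith

theorem cardinalHat_of_off_lattice {ξ : E d}
    (hξ : ∀ k : Fin d → ℤ, ξ + (2 * Real.pi) • lat k ≠ 0) : cardinalHat d c ξ =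
      negHat d c ‖ξ‖ / ∑' k : Fin d → ℤ, negHat d c ‖ξ + (2 * Real.pi) • lat k‖ := by
  have h0 : ξ ≠ 0 := by simpa [lat, ← Pi.zero_def] using hξ 0
  rw [cardinalHat, if_neg h0, if_neg (by simpa using hξ)]
  simp_rw [multiquadricHat_eq_neg]
  rw [tsum_neg, neg_div_neg_eq]

theorem tsum_negHat_pos (hc : 0 < c) {ξ : E d}
    (hξ : ∀ k : Fin d → ℤ, ξ + (2 * Real.pi) • lat k ≠ 0) :
    0 < ∑' k : Fin d → ℤ, negHat d c ‖ξ + (2 * Real.pi) • lat k‖ :=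
  (summable_negHat_add_lat hc ξ).tsum_pos (fun _ => negHat_nonneg hc (norm_nonneg _)) 0
    (negHat_pos hc (norm_pos_iff.2 (hξ 0)))

@[simp] theorem lat_zero : lat (0 : Fin d → ℤ) = 0 := by
  ext i; simp [lat]

theorem cardinalHat_zero : cardinalHat d c 0 = 1 := by simp [cardinalHat]

theorem cardinalHat_of_lattice {ξ : E d} (h0 : ξ ≠ 0) {k : Fin d → ℤ}
    (hk : ξ + (2 * Real.pi) • lat k = 0) : cardinalHat d c ξ = 0 := by
  rw [cardinalHat, if_neg h0, if_pos ⟨k, hk⟩]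

/-- `χ̂_c` near a point whose translate by `2πk₀` may vanish, written through `1 / φ̂_c` so that the
formula holds at that zero as well. -/
theorem cardinalHat_eq_of_near (hc : 0 < c) {ξ₀ ξ : E d} {k₀ : Fin d → ℤ}
    (hk₀ : ∀ i, |(ξ₀ + (2 * Real.pi) • lat k₀) i| ≤ Real.pi) (hξ : ξ ∈ Metric.ball ξ₀ 1) :
    cardinalHat d c ξ = (if k₀ = 0 then 1 else
      negHat d c ‖ξ‖ * (negHat d c ‖ξ + (2 * Real.pi) • lat k₀‖)⁻¹) /
      (1 + (negHat d c ‖ξ + (2 * Real.pi) • lat k₀‖)⁻¹ * tailSum d c k₀ ξ) := by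
  by_cases hlat : ∀ k : Fin d → ℤ, ξ + (2 * Real.pi) • lat k ≠ 0
  · have hp := negHat_pos (d := d) hc (norm_pos_iff.2 (hlat k₀))
    have ht := tailSum_nonneg hc ξ k₀
    have hden : 0 < negHat d c ‖ξ + (2 * Real.pi) • lat k₀‖ + tailSum d c k₀ ξ := by linarith
    rw [cardinalHat_of_off_lattice hlat, tsum_negHat_eq hc ξ k₀]
    split_ifs with h0
    · subst h0
      simp only [lat_zero, smul_zero, add_zero] at hp hden ⊢
      field_simp
    · field_simp
  · push Not at hlat
    obtain ⟨k, hk⟩ := hlat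
    have hkk : k = k₀ := by
      by_contra hne
      have := one_le_norm_add_lat hk₀ hξ hne
      rw [hk, norm_zero] at this
      linarith
    subst hkk
    rw [hk]
    simp only [norm_zero, negHat_zero, inv_zero, mul_zero, zero_mul, add_zero, div_one]
    split_ifs with h0
    · subst h0
      have : ξ = 0 := by simpa using hk
      rw [this, cardinalHat_zero]
    · refine cardinalHat_of_lattice (fun h => h0 ?_) hk
      have h2 : (2 * Real.pi) • lat k = (0 : E d) := by simpa [h] using hk
      funext i
      have h3 := congrArg (fun v : E d => v i) h2
      simpa [lat, Real.pi_ne_zero] using h3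

theorem continuous_cardinalHat (hc : 0 < c) : Continuous (cardinalHat d c) := by
  rw [continuous_iff_continuousAt]
  intro ξ₀
  obtain ⟨k₀, hk₀⟩ := exists_add_lat_le_pi ξ₀
  have hball := Metric.ball_mem_nhds ξ₀ one_pos
  have hinv : Continuous (fun ξ : E d => (negHat d c ‖ξ + (2 * Real.pi) • lat k₀‖)⁻¹) :=
    (continuous_inv_negHat_norm hc).comp (continuous_id.add continuous_const)
  refine ContinuousAt.congr ?_ (eventually_of_mem hball fun ξ hξ =>
    (cardinalHat_eq_of_near hc hk₀ hξ).symm)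
  refine ContinuousAt.div ?_ (continuousAt_const.add (hinv.continuousAt.mul
    ((continuousOn_tailSum hc hk₀).continuousAt hball))) ?_
  · split_ifs with h0
    · exact continuousAt_const
    · refine ContinuousAt.mul ?_ hinv.continuousAt
      have hpos : 0 < ‖ξ₀‖ := by
        have := one_le_norm_add_lat hk₀ (Metric.mem_ball_self one_pos) (Ne.symm h0)
        rw [lat_zero, smul_zero, add_zero] at this
        linarith
      exact ((continuousOn_negHat hc).continuousAt (Ioi_mem_nhds hpos)).comp
        continuous_norm.continuousAt
  · have h1 := inv_nonneg.2 (negHat_nonneg (d := d) hc (norm_nonneg (ξ₀ + (2 * Real.pi) • lat k₀)))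
    have h2 := tailSum_nonneg hc ξ₀ k₀
    positivity

/-! ### Bounds and integrability of `χ̂_c` -/

theorem cardinalHat_nonneg (hc : 0 < c) (ξ : E d) : 0 ≤ cardinalHat d c ξ := by
  by_cases h0 : ξ = 0
  · rw [h0, cardinalHat_zero]; exact zero_le_one
  by_cases hlat : ∀ k : Fin d → ℤ, ξ + (2 * Real.pi) • lat k ≠ 0
  · rw [cardinalHat_of_off_lattice hlat]
    exact div_nonneg (negHat_nonneg hc (norm_nonneg _)) (tsum_negHat_pos hc hlat).le
  · push Not at hlat
    obtain ⟨k, hk⟩ := hlat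
    rw [cardinalHat_of_lattice h0 hk]

/-- A term of the lattice sum closer to the origin than `ξ` makes `χ̂_c(ξ)` small. -/
theorem cardinalHat_le_exp_of_le (hc : 0 < c) {ξ : E d}
    (hlat : ∀ k : Fin d → ℤ, ξ + (2 * Real.pi) • lat k ≠ 0) {k : Fin d → ℤ}
    (hk : ‖ξ + (2 * Real.pi) • lat k‖ ≤ ‖ξ‖) :
    cardinalHat d c ξ ≤ Real.exp (-(c * (‖ξ‖ - ‖ξ + (2 * Real.pi) • lat k‖))) := by
  have hpos := norm_pos_iff.2 (hlat k)
  rw [cardinalHat_of_off_lattice hlat, div_le_iff₀ (tsum_negHat_pos hc hlat)]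
  refine (negHat_le_exp_mul hc hpos hk).trans (mul_le_mul_of_nonneg_left ?_ (Real.exp_pos _).le)
  exact (summable_negHat_add_lat hc ξ).le_tsum k fun j _ => negHat_nonneg hc (norm_nonneg _)

theorem cardinalHat_le_one (hc : 0 < c) (ξ : E d) : cardinalHat d c ξ ≤ 1 := by
  by_cases h0 : ξ = 0
  · rw [h0, cardinalHat_zero]
  by_cases hlat : ∀ k : Fin d → ℤ, ξ + (2 * Real.pi) • lat k ≠ 0
  · simpa using cardinalHat_le_exp_of_le hc hlat (k := 0) (by simp)
  · push Not at hlat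
    obtain ⟨k, hk⟩ := hlat
    rw [cardinalHat_of_lattice h0 hk]
    exact zero_le_one

/-- Decay of `χ̂_c`, by comparison with the term of the lattice sum that lies in `[-π, π]^d`, a cube
contained in the ball of radius `d π`. -/
theorem cardinalHat_le_exp (hc : 0 < c) (ξ : E d) :
    cardinalHat d c ξ ≤ Real.exp (-(c * (‖ξ‖ - d * Real.pi))) := by
  by_cases hle : ‖ξ‖ ≤ d * Real.pi
  · refine (cardinalHat_le_one hc ξ).trans (Real.one_le_exp ?_)
    nlinarith
  push Not at hle
  by_cases hlat : ∀ k : Fin d → ℤ, ξ + (2 * Real.pi) • lat k ≠ 0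
  · obtain ⟨k, hk⟩ := exists_add_lat_le_pi ξ
    have h1 : ‖ξ + (2 * Real.pi) • lat k‖ ≤ d * Real.pi :=
      (norm_le_sum_abs _).trans (by
        simpa using Finset.sum_le_sum fun i (_ : i ∈ Finset.univ) => hk i)
    refine (cardinalHat_le_exp_of_le hc hlat (h1.trans hle.le)).trans (Real.exp_le_exp.2 ?_)
    nlinarith
  · push Not at hlat
    obtain ⟨k, hk⟩ := hlat
    rw [cardinalHat_of_lattice (norm_pos_iff.1 ((by positivity : 0 ≤ d * Real.pi).trans_lt hle)) hk]
    exact (Real.exp_pos _).le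

theorem integrable_exp_neg_norm {α : ℝ} (hα : 0 < α) (d : ℕ) :
    Integrable (fun ξ : E d => Real.exp (-(α * ‖ξ‖))) := by
  have h := integrable_one_add_norm (E := E d) (μ := volume) (r := ((d + 1 : ℕ) : ℝ)) (by simp)
  refine (h.const_mul (Real.exp α * ((d + 1).factorial / α ^ (d + 1)))).mono'
    (by fun_prop) (Eventually.of_forall fun ξ => ?_)
  rw [Real.norm_of_nonneg (Real.exp_pos _).le, Real.rpow_neg (by positivity), Real.rpow_natCast]
  have h1 := Real.pow_div_factorial_le_exp (α * (1 + ‖ξ‖)) (by positivity) (d + 1)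
  have h2 : Real.exp (-(α * ‖ξ‖)) = Real.exp α * (Real.exp (α * (1 + ‖ξ‖)))⁻¹ := by
    rw [← Real.exp_neg, ← Real.exp_add]; ring_nf
  rw [h2, mul_assoc]
  refine mul_le_mul_of_nonneg_left ((inv_anti₀ (by positivity) h1).trans (le_of_eq ?_))
    (Real.exp_pos _).le
  rw [mul_pow]
  field_simp

theorem integrable_cardinalHat (hc : 0 < c) : Integrable (cardinalHat d c) := by
  refine ((integrable_exp_neg_norm hc d).const_mul (Real.exp (c * (d * Real.pi)))).mono'
    (continuous_cardinalHat hc).aestronglyMeasurable (Eventually.of_forall fun ξ => ?_)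
  rw [Real.norm_of_nonneg (cardinalHat_nonneg hc ξ), ← Real.exp_add]
  refine (cardinalHat_le_exp hc ξ).trans (le_of_eq ?_)
  ring_nf

/-! ### The limit `c → ∞` -/

theorem norm_lt_norm_of_abs_lt {v w : E d} (hle : ∀ i, |v i| ≤ |w i|) {i₀ : Fin d}
    (hlt : |v i₀| < |w i₀|) : ‖v‖ < ‖w‖ := by
  rw [EuclideanSpace.norm_eq, EuclideanSpace.norm_eq]
  refine Real.sqrt_lt_sqrt (Finset.sum_nonneg fun i _ => sq_nonneg _) ?_
  refine Finset.sum_lt_sum (fun i _ => pow_le_pow_left₀ (norm_nonneg _) (hle i) 2)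
    ⟨i₀, Finset.mem_univ _, ?_⟩
  exact pow_lt_pow_left₀ hlt (abs_nonneg _) two_ne_zero

theorem tendsto_exp_neg_mul_atTop {s : ℝ} (hs : 0 < s) :
    Tendsto (fun c : ℝ => Real.exp (-(c * s))) atTop (𝓝 0) :=
  Real.tendsto_exp_neg_atTop_nhds_zero.comp (tendsto_id.atTop_mul_const hs)

/-- If `ξ` is the strict minimizer of the norm in its class modulo `2πℤ^d`, the term `k = 0` dominates
the lattice sum as `c → ∞`. -/
theorem tendsto_cardinalHat_of_norm_lt {ξ : E d}
    (hlat : ∀ k : Fin d → ℤ, ξ + (2 * Real.pi) • lat k ≠ 0)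
    (h : ∀ k : Fin d → ℤ, k ≠ 0 → ‖ξ‖ < ‖ξ + (2 * Real.pi) • lat k‖) :
    Tendsto (fun c : ℝ => cardinalHat d c ξ) atTop (𝓝 1) := by
  have hξ : 0 < ‖ξ‖ := norm_pos_iff.2 (by simpa using hlat 0)
  have hlim : Tendsto (fun c : ℝ => ∑' k : Fin d → ℤ,
      negHat d c ‖ξ + (2 * Real.pi) • lat k‖ / negHat d c ‖ξ‖) atTop
      (𝓝 (∑' k : Fin d → ℤ, if k = 0 then (1 : ℝ) else 0)) := by
    have hbound : ∀ c : ℝ, 0 < c → ∀ k : Fin d → ℤ,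
        negHat d c ‖ξ + (2 * Real.pi) • lat k‖ / negHat d c ‖ξ‖ ≤
          Real.exp (-(c * (‖ξ + (2 * Real.pi) • lat k‖ - ‖ξ‖))) := fun c hc k => by
      rw [div_le_iff₀ (negHat_pos hc hξ)]
      refine negHat_le_exp_mul hc hξ ?_
      by_cases hk : k = 0
      · simp [hk]
      · exact (h k hk).le
    refine tendsto_tsum_of_dominated_convergence
      (bound := fun k => Real.exp ‖ξ‖ * Real.exp (-(1 * ‖ξ + (2 * Real.pi) • lat k‖)))
      ((summable_exp_neg_norm_add_lat one_pos ξ).mul_left _) (fun k => ?_) ?_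
    · by_cases hk : k = 0
      · simp only [hk, if_true, lat_zero, smul_zero, add_zero]
        refine tendsto_const_nhds.congr' ?_
        filter_upwards [eventually_gt_atTop 0] with c hc
        rw [div_self (negHat_pos hc hξ).ne']
      · simp only [hk, if_false]
        refine squeeze_zero' ?_ ?_ (tendsto_exp_neg_mul_atTop (sub_pos.2 (h k hk)))
        · filter_upwards [eventually_gt_atTop 0] with c hc
          exact div_nonneg (negHat_nonneg hc (norm_nonneg _)) (negHat_nonneg hc (norm_nonneg _))
        · filter_upwards [eventually_gt_atTop 0] with c hc
          exact hbound c hc k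
    · filter_upwards [eventually_ge_atTop 1] with c hc k
      have hc0 : 0 < c := one_pos.trans_le hc
      rw [Real.norm_of_nonneg (div_nonneg (negHat_nonneg hc0 (norm_nonneg _))
        (negHat_nonneg hc0 (norm_nonneg _)))]
      refine (hbound c hc0 k).trans ?_
      rw [← Real.exp_add, Real.exp_le_exp]
      have hle : ‖ξ‖ ≤ ‖ξ + (2 * Real.pi) • lat k‖ := by
        by_cases hk : k = 0
        · simp [hk]
        · exact (h k hk).le
      nlinarith
  rw [tsum_ite_eq] at hlim
  have hinv := hlim.inv₀ one_ne_zero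
  rw [inv_one] at hinv
  refine hinv.congr' ?_
  filter_upwards [eventually_gt_atTop 0] with c hc
  rw [cardinalHat_of_off_lattice hlat, tsum_div_const, inv_div]

theorem tendsto_cardinalHat (hd : 0 < d) {ξ : E d} (hξ : ‖WithLp.ofLp ξ‖ ≠ Real.pi) :
    Tendsto (fun c : ℝ => cardinalHat d c ξ) atTop
      (𝓝 ((cube d).indicator (fun _ => (1 : ℝ)) ξ)) := by
  have hpi := Real.pi_pos
  by_cases h0 : ξ = 0
  · subst h0
    have : (0 : E d) ∈ cube d := fun i => ⟨by simp [hpi.le], by simp [hpi.le]⟩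
    simp only [cardinalHat_zero, indicator_of_mem this]
    exact tendsto_const_nhds
  by_cases hlat : ∀ k : Fin d → ℤ, ξ + (2 * Real.pi) • lat k ≠ 0
  · by_cases hcube : ξ ∈ cube d
    · rw [indicator_of_mem hcube]
      have hne : Nonempty (Fin d) := ⟨⟨0, hd⟩⟩
      have hlt : ∀ i, |ξ i| < Real.pi := fun i => by
        have h1 : ‖WithLp.ofLp ξ‖ ≤ Real.pi :=
          (pi_norm_le_iff_of_nonneg hpi.le).2 fun i => abs_le.2 (hcube i)
        exact (norm_le_pi_norm (WithLp.ofLp ξ) i).trans_lt (lt_of_le_of_ne h1 hξ)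
      refine tendsto_cardinalHat_of_norm_lt hlat fun k hk => ?_
      have hcoord : ∀ i, k i ≠ 0 → |ξ i| < |(ξ + (2 * Real.pi) • lat k) i| := fun i hi => by
        rw [add_lat_apply]
        have h1 : (1 : ℝ) ≤ |(k i : ℝ)| := by exact_mod_cast Int.one_le_abs hi
        have h2 : |2 * Real.pi * (k i : ℝ)| ≤ |ξ i + 2 * Real.pi * k i| + |ξ i| := by
          simpa using abs_sub (ξ i + 2 * Real.pi * k i) (ξ i)
        rw [abs_mul, abs_of_pos Real.two_pi_pos] at h2
        nlinarith [hlt i]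
      obtain ⟨i₀, hi₀⟩ := Function.ne_iff.1 hk
      refine norm_lt_norm_of_abs_lt (fun i => ?_) (hcoord i₀ hi₀)
      by_cases hi : k i = 0
      · rw [add_lat_apply, hi]; simp
      · exact (hcoord i hi).le
    · rw [indicator_of_notMem hcube]
      obtain ⟨i, hi⟩ : ∃ i, Real.pi < |ξ i| := by
        by_contra hcon
        push Not at hcon
        exact hcube fun i => abs_le.1 (hcon i)
      -- A shift of the `i`-th coordinate by `±2π` brings `ξ` closer to the origin.
      obtain ⟨m, hm⟩ : ∃ m : ℤ, |ξ i + 2 * Real.pi * m| < |ξ i| := by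
        rcases le_total 0 (ξ i) with hs | hs
        · refine ⟨-1, ?_⟩
          rw [abs_of_nonneg hs] at hi ⊢
          push_cast
          rw [abs_lt]; constructor <;> linarith
        · refine ⟨1, ?_⟩
          rw [abs_of_nonpos hs] at hi ⊢
          push_cast
          rw [abs_lt]; constructor <;> linarith
      have hlt : ‖ξ + (2 * Real.pi) • lat (Pi.single i m)‖ < ‖ξ‖ := by
        refine norm_lt_norm_of_abs_lt (fun j => ?_) (i₀ := i) (by
          rw [add_lat_apply]; simpa using hm)
        rw [add_lat_apply]
        by_cases hj : j = i
        · subst hj; simpa using hm.le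
        · simp [hj]
      refine squeeze_zero' ?_ ?_ (tendsto_exp_neg_mul_atTop (sub_pos.2 hlt))
      · filter_upwards [eventually_gt_atTop 0] with c hc
        exact cardinalHat_nonneg hc ξ
      · filter_upwards [eventually_gt_atTop 0] with c hc
        exact cardinalHat_le_exp_of_le hc hlat hlt.le
  · push Not at hlat
    obtain ⟨k, hk⟩ := hlat
    simp only [cardinalHat_of_lattice h0 hk]
    have : ξ ∉ cube d := fun hcube => h0 <| by
      ext i
      have h1 : ξ i + 2 * Real.pi * k i = 0 := by rw [← add_lat_apply, hk]; rfl
      have h2 : |ξ i| ≤ Real.pi := abs_le.2 (hcube i)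
      have h3 : k i = 0 := by
        by_contra hne
        have h4 : (1 : ℝ) ≤ |(k i : ℝ)| := by exact_mod_cast Int.one_le_abs hne
        have h5 : |ξ i| = 2 * Real.pi * |(k i : ℝ)| := by
          rw [eq_neg_of_add_eq_zero_left h1, abs_neg, abs_mul, abs_of_pos Real.two_pi_pos]
        nlinarith
      simpa [h3] using h1
    rw [indicator_of_notMem this]
    exact tendsto_const_nhds

/-! ### Point measures and plane waves on the lattice -/

theorem integral_count_eq_tsum {ι : Type*} [Countable ι] [MeasurableSpace ι]
    [MeasurableSingletonClass ι] {f : ι → ℂ} (hf : Summable fun j => ‖f j‖) :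
    ∫ j, f j ∂Measure.count = ∑' j, f j := by
  rw [integral_countable (integrable_count_iff.2 hf)]
  simp

/-- The form of `integral_mul_multiquadric` for measures supported on countably many points. -/
theorem tsum_mul_multiquadric (hd : 0 < d) (hc : 0 < c) {ι : Type*} [Countable ι] {w : ι → ℂ}
    {p : ι → E d} (hw : Summable fun j => ‖w j‖)
    (hwφ : Summable fun j => ‖w j * ((multiquadric c ‖p j‖ : ℝ) : ℂ)‖) (h0 : ∑' j, w j = 0)
    (hint : Integrable fun ξ : E d => (∑' j, w j * planeWave (p j) ξ) *
      ((negHat d c ‖ξ‖ : ℝ) : ℂ)) :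
    ∑' j, w j * ((multiquadric c ‖p j‖ : ℝ) : ℂ) =
      -(((2 * Real.pi) ^ (-(d : ℝ)) : ℝ) : ℂ) * ∫ ξ : E d, (∑' j, w j * planeWave (p j) ξ) *
      ((negHat d c ‖ξ‖ : ℝ) : ℂ) := by
  let : MeasurableSpace ι := ⊤
  have hu : ∀ ξ, ∫ j, w j * planeWave (p j) ξ ∂Measure.count = ∑' j, w j * planeWave (p j) ξ :=
    fun ξ => integral_count_eq_tsum (by simpa using hw)
  have key := integral_mul_multiquadric (μ := Measure.count) (w := w) (p := p) hd hc
    (measurable_from_top) (integrable_count_iff.2 hw) (integrable_count_iff.2 hwφ)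
    (by rw [integral_count_eq_tsum hw, h0]) (by simp_rw [hu]; exact hint)
  simp_rw [hu] at key
  rwa [integral_count_eq_tsum hwφ] at key

theorem lat_add (j k : Fin d → ℤ) : lat (j + k) = lat j + lat k := by
  ext i; simp [lat]

theorem lat_neg (j : Fin d → ℤ) : lat (-j) = -lat j := by
  ext i; simp [lat]

theorem planeWave_add_lat (m k : Fin d → ℤ) (ξ : E d) :
    planeWave (lat m) (ξ + (2 * Real.pi) • lat k) = planeWave (lat m) ξ := by
  rw [planeWave_comm, planeWave_add_left, planeWave_comm ξ]
  refine mul_eq_left₀ (Complex.exp_ne_zero _) |>.2 ?_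
  rw [planeWave, Complex.exp_eq_one_iff]
  refine ⟨∑ i, m i * k i, ?_⟩
  simp only [inner_smul_left, lat, PiLp.inner_apply, RCLike.inner_apply, conj_trivial]
  push_cast
  ring

/-! ### Trigonometric polynomials -/

/-- Evaluation at `ξ` of the trigonometric polynomial `∑ q_m exp(-i m·ξ)`. -/
def trigEval (ξ : E d) : AddMonoidAlgebra ℂ (Fin d → ℤ) →ₐ[ℂ] ℂ :=
  AddMonoidAlgebra.lift ℂ ℂ (Fin d → ℤ)
    { toFun := fun m => planeWave (lat (-m.toAdd)) ξ
      map_one' := by simp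
      map_mul' := fun m n => by
        rw [toAdd_mul, neg_add, lat_add, planeWave_add_left] }

theorem trigEval_single (ξ : E d) (m : Fin d → ℤ) (b : ℂ) :
    trigEval ξ (AddMonoidAlgebra.single m b) = b * planeWave (lat (-m)) ξ := by
  rw [trigEval, AddMonoidAlgebra.lift_single]
  rfl

theorem trigEval_eq_sum (ξ : E d) (q : AddMonoidAlgebra ℂ (Fin d → ℤ)) :
    trigEval ξ q = ∑ m ∈ q.coeff.support, q.coeff m * planeWave (lat (-m)) ξ := by
  rw [trigEval, AddMonoidAlgebra.lift_apply]
  rfl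

theorem continuous_trigEval (q : AddMonoidAlgebra ℂ (Fin d → ℤ)) :
    Continuous fun ξ : E d => trigEval ξ q := by
  simp_rw [trigEval_eq_sum]
  fun_prop

theorem trigEval_add_lat (q : AddMonoidAlgebra ℂ (Fin d → ℤ)) (ξ : E d) (k : Fin d → ℤ) :
    trigEval (ξ + (2 * Real.pi) • lat k) q = trigEval ξ q := by
  simp_rw [trigEval_eq_sum, planeWave_add_lat]

/-- The trigonometric polynomial `(∑ (2 - 2 cos ξ_i))^(d+1)`, which vanishes only on the lattice
`2πℤ^d`, to an order that compensates the singularity of `φ̂_c`. -/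
def vanishingPoly (d : ℕ) : AddMonoidAlgebra ℂ (Fin d → ℤ) :=
  (∑ i : Fin d, (2 - AddMonoidAlgebra.single (Pi.single i 1) 1 -
    AddMonoidAlgebra.single (-Pi.single i 1) 1)) ^ (d + 1)

/-- The values of `vanishingPoly`. -/
def vanishingFun (ξ : E d) : ℝ := (∑ i, (2 - 2 * Real.cos (ξ i))) ^ (d + 1)

theorem planeWave_lat_single (ξ : E d) (i : Fin d) (m : ℤ) :
    planeWave (lat (Pi.single i m)) ξ = Complex.exp (((m * ξ i : ℝ) : ℂ) * Complex.I) := by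
  have : inner ℝ (lat (Pi.single i m)) ξ = m * ξ i := by
    simp only [lat, PiLp.inner_apply, RCLike.inner_apply, conj_trivial]
    rw [Finset.sum_eq_single i]
    · simp [mul_comm]
    · intro j _ hj; simp [hj]
    · simp
  rw [planeWave, this, mul_comm]

theorem trigEval_vanishingPoly (ξ : E d) :
    trigEval ξ (vanishingPoly d) = ((vanishingFun ξ : ℝ) : ℂ) := by
  rw [vanishingPoly, map_pow, map_sum, vanishingFun, Complex.ofReal_pow, Complex.ofReal_sum]
  congr 1
  refine Finset.sum_congr rfl fun i _ => ?_
  rw [map_sub, map_sub, trigEval_single, trigEval_single, map_ofNat, neg_neg, ← Pi.single_neg,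
    planeWave_lat_single, planeWave_lat_single]
  push_cast
  rw [Complex.cos]
  simp
  ring

theorem two_sub_two_mul_cos_nonneg (x : ℝ) : 0 ≤ 2 - 2 * Real.cos x := by
  linarith [Real.cos_le_one x]

theorem vanishingFun_nonneg (ξ : E d) : 0 ≤ vanishingFun ξ :=
  pow_nonneg (Finset.sum_nonneg fun _ _ => two_sub_two_mul_cos_nonneg _) _

theorem vanishingFun_le_norm_pow (ξ : E d) : vanishingFun ξ ≤ ‖ξ‖ ^ (2 * (d + 1)) := by
  rw [pow_mul, EuclideanSpace.norm_sq_eq]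
  refine pow_le_pow_left₀ (Finset.sum_nonneg fun i _ => two_sub_two_mul_cos_nonneg _)
    (Finset.sum_le_sum fun i _ => ?_) _
  rw [Real.norm_eq_abs, sq_abs]
  linarith [Real.one_sub_sq_div_two_le_cos (x := ξ i)]

theorem vanishingFun_le_const (ξ : E d) : vanishingFun ξ ≤ (4 * d) ^ (d + 1) := by
  refine pow_le_pow_left₀ (Finset.sum_nonneg fun i _ => two_sub_two_mul_cos_nonneg _) ?_ _
  calc ∑ i, (2 - 2 * Real.cos (ξ i)) ≤ ∑ _i : Fin d, (4 : ℝ) :=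
        Finset.sum_le_sum fun i _ => by linarith [Real.neg_one_le_cos (ξ i)]
    _ = 4 * d := by simp [mul_comm]

theorem vanishingFun_ne_zero {ξ : E d} (hlat : ∀ k : Fin d → ℤ, ξ + (2 * Real.pi) • lat k ≠ 0) :
    vanishingFun ξ ≠ 0 := by
  intro h
  have h1 := (pow_eq_zero_iff d.succ_ne_zero).1 h
  rw [Finset.sum_eq_zero_iff_of_nonneg fun i _ => two_sub_two_mul_cos_nonneg _] at h1
  have h2 : ∀ i, ∃ n : ℤ, (n : ℝ) * (2 * Real.pi) = ξ i := fun i => by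
    rw [← Real.cos_eq_one_iff]
    linarith [h1 i (Finset.mem_univ i)]
  choose n hn using h2
  refine hlat (-n) ?_
  ext i
  rw [add_lat_apply, ← hn i]
  simp
  ring

/-- An integrable bound of `Q φ̂_c` for the vanishing polynomial `Q`. -/
theorem exists_vanishingFun_mul_negHat_le (hc : 0 < c) (d : ℕ) :
    ∃ C : ℝ, ∀ ξ : E d, vanishingFun ξ * negHat d c ‖ξ‖ ≤ C * Real.exp (-(c * ‖ξ‖)) := by
  obtain ⟨C₀, hC₀, hC⟩ := exists_negHat_le d hc
  have h1 := (negHat_pos (d := d) hc one_pos).le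
  refine ⟨C₀ * Real.exp c + (4 * d) ^ (d + 1) * (Real.exp c * negHat d c 1), fun ξ => ?_⟩
  rw [add_mul]
  rcases le_total ‖ξ‖ 1 with hle | hle
  · refine le_trans ?_ (le_add_of_nonneg_right (by positivity))
    have h2 : 1 ≤ Real.exp c * Real.exp (-(c * ‖ξ‖)) := by
      rw [← Real.exp_add]; exact Real.one_le_exp (by nlinarith)
    have h3 : vanishingFun ξ * negHat d c ‖ξ‖ ≤ C₀ := by
      rcases (norm_nonneg ξ).eq_or_lt with h0 | h0
      · rw [← h0, negHat_zero, mul_zero]; exact hC₀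
      · refine le_trans ?_ (hC _ h0 hle)
        rw [mul_comm]
        exact mul_le_mul_of_nonneg_left (vanishingFun_le_norm_pow ξ) (negHat_pos hc h0).le
    rw [mul_assoc]
    nlinarith
  · refine le_trans ?_ (le_add_of_nonneg_left (by positivity))
    rw [mul_assoc]
    exact mul_le_mul (vanishingFun_le_const ξ) (negHat_le_of_one_le hc hle)
      (negHat_nonneg hc (norm_nonneg _)) (by positivity)

theorem setIntegral_unitCube_mFourier (m : Fin d → ℤ) :
    ∫ x in unitCube d, UnitAddTorus.mFourier m (toTorus x) = if m = 0 then 1 else 0 := by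
  have h1 : ∀ x : Fin d → ℝ, (unitCube d).indicator (fun x =>
      UnitAddTorus.mFourier m (toTorus x)) x =
      ∏ i, (Ioc (0 : ℝ) 1).indicator (fun t => Complex.exp ((2 * Real.pi * Complex.I * m i) * t))
          (x i) := by
    intro x
    by_cases hx : x ∈ unitCube d
    · rw [indicator_of_mem hx]
      simp only [UnitAddTorus.mFourier, toTorus, ContinuousMap.coe_mk, fourier_coe_apply]
      refine Finset.prod_congr rfl fun i _ => ?_
      rw [indicator_of_mem (hx i)]
      simp
    · rw [indicator_of_notMem hx]
      simp only [unitCube, mem_ofPred_eq, not_forall] at hx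
      obtain ⟨i, hi⟩ := hx
      exact (Finset.prod_eq_zero (Finset.mem_univ i) (indicator_of_notMem hi _)).symm
  rw [← integral_indicator measurableSet_unitCube]
  simp_rw [h1]
  rw [integral_fintype_prod_volume_eq_prod (fun i => (Ioc (0 : ℝ) 1).indicator
    (fun t : ℝ => Complex.exp ((2 * Real.pi * Complex.I * m i) * t)))]
  have h2 : ∀ n : ℤ, ∫ t : ℝ, (Ioc (0 : ℝ) 1).indicator
      (fun t => Complex.exp ((2 * Real.pi * Complex.I * n) * t)) t = if n = 0 then 1 else 0 := by
    intro n
    rw [integral_indicator measurableSet_Ioc, ← intervalIntegral.integral_of_le zero_le_one]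
    split_ifs with hn
    · simp [hn]
    · have hne : (2 * Real.pi * Complex.I * n : ℂ) ≠ 0 := by
        simp [Real.pi_ne_zero, hn]
      rw [integral_exp_mul_complex hne]
      have : Complex.exp (2 * Real.pi * Complex.I * n) = 1 :=
        Complex.exp_eq_one_iff.2 ⟨n, by ring⟩
      simp [this]
  simp_rw [h2]
  split_ifs with hm
  · simp [hm]
  · obtain ⟨i, hi⟩ := Function.ne_iff.1 hm
    exact Finset.prod_eq_zero (Finset.mem_univ i) (if_neg hi)

/-- The half-open cube `(0, 2π]^d`, a fundamental domain of `2πℤ^d`. -/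
def periodCube (d : ℕ) : Set (E d) := {ξ | ∀ i, ξ i ∈ Ioc 0 (2 * Real.pi)}

theorem measurableSet_periodCube : MeasurableSet (periodCube d) := by
  have : periodCube d = ⋂ i, (fun ξ : E d => ξ i) ⁻¹' Ioc 0 (2 * Real.pi) := by
    ext ξ; simp [periodCube]
  rw [this]
  exact MeasurableSet.iInter fun i => measurableSet_Ioc.preimage (by fun_prop)

theorem smul_toLp_mem_periodCube (x : Fin d → ℝ) :
    (2 * Real.pi) • (WithLp.toLp 2 x : E d) ∈ periodCube d ↔ x ∈ unitCube d := by
  have h := Real.two_pi_pos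
  refine forall_congr' fun i => ?_
  simp only [PiLp.smul_apply, smul_eq_mul, mem_Ioc]
  constructor
  · rintro ⟨h1, h2⟩; constructor <;> nlinarith
  · rintro ⟨h1, h2⟩; constructor <;> nlinarith

theorem integral_comp_smul_toLp (f : E d → ℂ) :
    ∫ ξ, f ξ = (((2 * Real.pi) ^ d : ℝ) : ℂ) *
      ∫ x : Fin d → ℝ, f ((2 * Real.pi) • WithLp.toLp 2 x) := by
  rw [(PiLp.volume_preserving_toLp (Fin d)).integral_comp
    (MeasurableEquiv.toLp 2 _).measurableEmbedding (fun ξ => f ((2 * Real.pi) • ξ)),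
    Measure.integral_comp_smul, finrank_euclideanSpace_fin, abs_of_pos (by positivity),
    Complex.real_smul, ← mul_assoc, ← Complex.ofReal_mul, mul_inv_cancel₀ (by positivity)]
  simp

theorem integrableOn_periodCube {f : E d → ℂ} (hf : Continuous f) :
    IntegrableOn f (periodCube d) := by
  have hb : Bornology.IsBounded (periodCube d) := by
    refine (Metric.isBounded_closedBall (x := (0 : E d)) (r :=
        d * (2 * Real.pi))).subset fun ξ hξ => ?_
    rw [mem_closedBall_zero_iff]
    refine (norm_le_sum_abs ξ).trans ?_
    have : ∀ i ∈ Finset.univ, |ξ i| ≤ 2 * Real.pi := fun i _ => by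
      rw [abs_of_pos (hξ i).1]; exact (hξ i).2
    simpa using Finset.sum_le_sum this
  exact (hf.continuousOn.integrableOn_compact hb.isCompact_closure).mono_set subset_closure

theorem setIntegral_periodCube_trigEval (q : AddMonoidAlgebra ℂ (Fin d → ℤ)) :
    ∫ ξ in periodCube d, trigEval ξ q = (((2 * Real.pi) ^ d : ℝ) : ℂ) * q.coeff 0 := by
  have h1 : ∀ m : Fin d → ℤ, ∫ ξ in periodCube d, planeWave (lat (-m)) ξ =
      (((2 * Real.pi) ^ d : ℝ) : ℂ) * if m = 0 then 1 else 0 := fun m => by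
    rw [← integral_indicator measurableSet_periodCube, integral_comp_smul_toLp]
    congr 1
    have h2 : ∀ x : Fin d → ℝ, (periodCube d).indicator (fun ξ => planeWave (lat (-m)) ξ)
        ((2 * Real.pi) • WithLp.toLp 2 x) =
        (unitCube d).indicator (fun x => UnitAddTorus.mFourier (-m) (toTorus x)) x := fun x => by
      by_cases hx : x ∈ unitCube d
      · rw [indicator_of_mem hx, indicator_of_mem ((smul_toLp_mem_periodCube x).2 hx),
          mFourier_toTorus]
      · rw [indicator_of_notMem hx, indicator_of_notMem ((smul_toLp_mem_periodCube x).not.2 hx)]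
    simp_rw [h2]
    rw [integral_indicator measurableSet_unitCube, setIntegral_unitCube_mFourier]
    simp
  simp_rw [trigEval_eq_sum]
  rw [integral_finsetSum _ fun m _ => (integrableOn_periodCube (by fun_prop))]
  simp_rw [integral_const_mul, h1]
  have h3 : ∀ m : Fin d → ℤ, q.coeff m * ((((2 * Real.pi) ^ d : ℝ) : ℂ) * if m = 0 then 1 else 0) =
      if m = 0 then (((2 * Real.pi) ^ d : ℝ) : ℂ) * q.coeff 0 else 0 := fun m => by
    split_ifs with h
    · rw [h]; ring
    · simp
  simp_rw [h3]
  rw [Finset.sum_ite_eq' q.coeff.support 0]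
  split_ifs with h
  · rfl
  · rw [Finsupp.notMem_support_iff.1 h, mul_zero]

/-- Every point has exactly one translate in the period cube. -/
theorem exists_add_lat_mem_periodCube_iff (ξ : E d) :
    ∃ k₀ : Fin d → ℤ, ∀ k, ξ + (2 * Real.pi) • lat k ∈ periodCube d ↔ k = k₀ := by
  have h := Real.two_pi_pos
  obtain ⟨k₀, hk₀⟩ := exists_add_intVec_mem_unitCube ((2 * Real.pi)⁻¹ • WithLp.ofLp ξ)
  have h2 : ∀ k, ξ + (2 * Real.pi) • lat k ∈ periodCube d ↔
      (2 * Real.pi)⁻¹ • WithLp.ofLp ξ + intVec k ∈ unitCube d := fun k => by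
    rw [← smul_toLp_mem_periodCube]
    congr! 1
    ext i
    simp [lat, intVec]
    field_simp
  refine ⟨k₀, fun k => (h2 k).trans ⟨fun hk => ?_, fun hk => hk ▸ hk₀⟩⟩
  by_contra hne
  exact disjoint_left.1 (pairwise_disjoint_preimage_unitCube hne) hk hk₀

/-! ### The coefficient series of a cardinal function -/

/-- The trigonometric series `A(ξ) = ∑ a_j exp(-i j·ξ)`. -/
def trigSeries (a : (Fin d → ℤ) → ℝ) (ξ : E d) : ℂ := ∑' j, (a j : ℂ) * planeWave (lat (-j)) ξ

section Series

variable {a : (Fin d → ℤ) → ℝ}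

theorem summable_abs_of_summable_mul_multiquadric (hc : 0 < c)
    (h : Summable fun j => a j * multiquadric c ‖(0 : E d) - lat j‖) : Summable fun j => |a j| := by
  refine Summable.of_nonneg_of_le (fun j => abs_nonneg _) (fun j => ?_) (h.abs.mul_left c⁻¹)
  have h1 : c ≤ multiquadric c ‖(0 : E d) - lat j‖ :=
    Real.le_sqrt_of_sq_le (by nlinarith [sq_nonneg ‖(0 : E d) - lat j‖])
  rw [abs_mul, abs_of_pos (hc.trans_le h1), inv_mul_eq_div, le_div_iff₀ hc]
  exact mul_le_mul_of_nonneg_left h1 (abs_nonneg _)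

theorem summable_norm_trigSeries (ha : Summable fun j => |a j|) (ξ : E d) :
    Summable fun j => ‖(a j : ℂ) * planeWave (lat (-j)) ξ‖ := by
  simpa using ha

theorem continuous_trigSeries (ha : Summable fun j => |a j|) : Continuous (trigSeries a) :=
  continuous_tsum (fun j => by fun_prop) ha fun j ξ => by simp

theorem norm_trigSeries_le (ha : Summable fun j => |a j|) (ξ : E d) :
    ‖trigSeries a ξ‖ ≤ ∑' j, |a j| := by
  refine (norm_tsum_le_tsum_norm (summable_norm_trigSeries ha ξ)).trans (le_of_eq ?_)
  simp

theorem trigSeries_add_lat (ξ : E d) (k : Fin d → ℤ) :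
    trigSeries a (ξ + (2 * Real.pi) • lat k) = trigSeries a ξ := by
  simp_rw [trigSeries, planeWave_add_lat]

/-- The finitely supported combinations `∑ q_m χ(-m)` of the interpolation conditions, computed on
the Fourier side. -/
theorem coeff_zero_eq_integral (hd : 0 < d) (hc : 0 < c)
    (ha : ∀ x : E d, Summable fun j => a j * multiquadric c ‖x - lat j‖)
    (hδ : ∀ k : Fin d → ℤ, ∑' j, a j * multiquadric c ‖(lat k : E d) - lat j‖ = if k =
        0 then 1 else 0)
    (q : AddMonoidAlgebra ℂ (Fin d → ℤ)) (hq : trigEval (0 : E d) q = 0)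
    (hint : Integrable fun ξ : E d => trigEval ξ q * trigSeries a ξ * ((negHat d c ‖ξ‖ : ℝ) : ℂ)) :
    q.coeff 0 = -(((2 * Real.pi) ^ (-(d : ℝ)) : ℝ) : ℂ) *
      ∫ ξ : E d, trigEval ξ q * trigSeries a ξ * ((negHat d c ‖ξ‖ : ℝ) : ℂ) := by
  have hAbs := summable_abs_of_summable_mul_multiquadric hc (ha 0)
  set S := q.coeff.support with hS
  let w : S × (Fin d → ℤ) → ℂ := fun z => q.coeff z.1 * a z.2
  let p : S × (Fin d → ℤ) → E d := fun z => lat (-z.1.1) - lat z.2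
  have hprod : ∀ ξ : E d, ∑' z, w z * planeWave (p z) ξ = trigEval ξ q * trigSeries a ξ :=
      fun ξ => by
    have h1 := tsum_mul_tsum_of_summable_norm (f := fun m : S =>
        q.coeff m * planeWave (lat (-m.1)) ξ)
      (hasSum_fintype _).summable (summable_norm_trigSeries hAbs ξ)
    rw [tsum_fintype, Finset.sum_coe_sort S (fun m => q.coeff m * planeWave (lat (-m)) ξ),
      ← trigEval_eq_sum] at h1
    refine Eq.trans (tsum_congr fun z => ?_) h1.symm
    simp only [w, p]
    rw [sub_eq_add_neg, ← lat_neg, planeWave_add_left]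
    ring
  have hw : Summable fun z => ‖w z‖ := by
    have h1 := Summable.mul_norm (f := fun m : S => q.coeff m) (g := fun j => (a j : ℂ))
      (hasSum_fintype _).summable (by simpa using hAbs)
    exact h1
  have hwφ : Summable fun z => ‖w z * ((multiquadric c ‖p z‖ : ℝ) : ℂ)‖ := by
    refine (summable_prod_of_nonneg fun z => norm_nonneg _).2
      ⟨fun m => ?_, (hasSum_fintype _).summable⟩
    refine (((ha (lat (-m.1))).norm.mul_left ‖q.coeff m‖)).congr fun j => ?_
    simp only [w, p, norm_mul, Complex.norm_real, mul_assoc]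
  have h0 : ∑' z, w z = 0 := by
    have h1 := hprod 0
    rw [hq, zero_mul] at h1
    simpa using h1
  have key := tsum_mul_multiquadric hd hc hw hwφ h0 (by simp_rw [hprod]; exact hint)
  simp_rw [hprod] at key
  rw [← key, hwφ.of_norm.tsum_prod, tsum_fintype]
  have h2 : ∀ m : S, ∑' j, w (m, j) * ((multiquadric c ‖p (m, j)‖ : ℝ) : ℂ) =
      if m.1 = 0 then q.coeff 0 else 0 := fun m => by
    have h3 : ∀ j, w (m, j) * ((multiquadric c ‖p (m, j)‖ : ℝ) : ℂ) =
        q.coeff m * ((a j * multiquadric c ‖(lat (-m.1) : E d) - lat j‖ : ℝ) : ℂ) := fun j => by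
      simp only [w, p]; push_cast; ring
    simp_rw [h3]
    rw [tsum_mul_left, ← Complex.ofReal_tsum, hδ]
    by_cases hm : m.1 = 0
    · simp [hm]
    · simp [hm]
  simp_rw [h2]
  rw [Finset.sum_coe_sort S (fun m => if m = 0 then q.coeff 0 else 0), Finset.sum_ite_eq' S 0]
  split_ifs with h
  · rfl
  · exact Finsupp.notMem_support_iff.1 h

theorem ae_off_lattice (hd : 0 < d) :
    ∀ᵐ ξ : E d, ∀ k : Fin d → ℤ, ξ + (2 * Real.pi) • lat k ≠ 0 := by
  have : Nonempty (Fin d) := ⟨⟨0, hd⟩⟩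
  refine ae_all_iff.2 fun k => ?_
  have : {ξ : E d | ¬ ξ + (2 * Real.pi) • lat k ≠ 0} ⊆ {-((2 * Real.pi) • lat k)} := fun ξ hξ => by
    simp only [ne_eq, not_not, mem_ofPred_eq] at hξ
    exact eq_neg_of_add_eq_zero_left hξ
  exact measure_mono_null this (by simp)

/-- The interpolation conditions determine the series: `A(ξ) ∑_k φ̂_c(ξ + 2πk) = 1`. -/
theorem ae_trigSeries_mul_tsum (hd : 0 < d) (hc : 0 < c)
    (ha : ∀ x : E d, Summable fun j => a j * multiquadric c ‖x - lat j‖)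
    (hδ : ∀ k : Fin d → ℤ, ∑' j, a j * multiquadric c ‖(lat k : E d) - lat j‖ = if k =
        0 then 1 else 0) :
    ∀ᵐ ξ : E d, trigSeries a ξ *
      ((∑' k : Fin d → ℤ, negHat d c ‖ξ + (2 * Real.pi) • lat k‖ : ℝ) : ℂ) = -1 := by
  have hAbs := summable_abs_of_summable_mul_multiquadric hc (ha 0)
  have hAc := continuous_trigSeries hAbs
  have hvan : Continuous fun ξ : E d => ((vanishingFun ξ : ℝ) : ℂ) := by
    simp_rw [← trigEval_vanishingPoly]; exact continuous_trigEval _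
  have hint : Integrable fun ξ : E d =>
      ((vanishingFun ξ : ℝ) : ℂ) * trigSeries a ξ * ((negHat d c ‖ξ‖ : ℝ) : ℂ) := by
    obtain ⟨C, hC⟩ := exists_vanishingFun_mul_negHat_le hc d
    refine (((integrable_exp_neg_norm hc d).const_mul C).const_mul (∑' j, |a j|)).mono' ?_
      (Eventually.of_forall fun ξ => ?_)
    · exact (hvan.mul hAc).aestronglyMeasurable.mul
        (Complex.measurable_ofReal.comp (measurable_negHat_norm hc)).aestronglyMeasurable
    · rw [norm_mul, norm_mul, Complex.norm_real, Complex.norm_real,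
        Real.norm_of_nonneg (vanishingFun_nonneg ξ),
        Real.norm_of_nonneg (negHat_nonneg hc (norm_nonneg _))]
      have h1 := mul_nonneg (vanishingFun_nonneg ξ) (negHat_nonneg (d := d) hc (norm_nonneg ξ))
      calc _ = ‖trigSeries a ξ‖ * (vanishingFun ξ * negHat d c ‖ξ‖) := by ring
        _ ≤ _ := mul_le_mul (norm_trigSeries_le hAbs ξ) (hC ξ) h1
          (tsum_nonneg fun j => abs_nonneg _)
  have hindint : Integrable ((periodCube d).indicator fun ξ : E d => ((vanishingFun ξ : ℝ) : ℂ)) :=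
    (integrable_indicator_iff measurableSet_periodCube).2 (integrableOn_periodCube hvan)
  -- The Fourier transform of this function vanishes on the lattice,
  -- and its periodization is `Q (A ∑ + 1)`.
  have hae := ae_tsum_add_lat_eq_zero (F := fun ξ =>
    ((vanishingFun ξ : ℝ) : ℂ) * trigSeries a ξ * ((negHat d c ‖ξ‖ : ℝ) : ℂ) +
      (periodCube d).indicator (fun ξ => ((vanishingFun ξ : ℝ) : ℂ)) ξ) (hint.add hindint) fun n =>
          by
    set q : AddMonoidAlgebra ℂ (Fin d → ℤ) := AddMonoidAlgebra.single (-n) 1 * vanishingPoly d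
    have hqe : ∀ ξ : E d, trigEval ξ q = planeWave (lat n) ξ * ((vanishingFun ξ : ℝ) : ℂ) :=
        fun ξ => by
      rw [map_mul, trigEval_vanishingPoly, trigEval_single, neg_neg, one_mul]
    have hpw : ∀ {f : E d → ℂ}, Integrable f → Integrable fun ξ => planeWave (lat n) ξ * f ξ :=
      fun hf => hf.bdd_mul (c := 1) (continuous_planeWave_right _).aestronglyMeasurable
        (Eventually.of_forall fun ξ => (norm_planeWave _ _).le)
    have h0 : trigEval (0 : E d) q = 0 := by
      have hv : vanishingFun (0 : E d) = 0 := by simp [vanishingFun]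
      rw [hqe, hv]; simp
    have h1 := coeff_zero_eq_integral hd hc ha hδ q h0 ((hpw hint).congr
      (Eventually.of_forall fun ξ => by simp only [hqe]; ring))
    have h2 := setIntegral_periodCube_trigEval q
    simp_rw [mul_add]
    rw [integral_add (hpw hint) (hpw hindint)]
    have h3 : ∫ ξ : E d, planeWave (lat n) ξ *
        (periodCube d).indicator (fun ξ => ((vanishingFun ξ : ℝ) : ℂ)) ξ =
        ∫ ξ in periodCube d, trigEval ξ q := by
      rw [← integral_indicator measurableSet_periodCube]
      refine integral_congr_ae (Eventually.of_forall fun ξ => ?_)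
      by_cases hξ : ξ ∈ periodCube d <;> simp [hξ, hqe]
    have h4 : ∫ ξ : E d, planeWave (lat n) ξ * (((vanishingFun ξ : ℝ) : ℂ) * trigSeries a ξ *
        ((negHat d c ‖ξ‖ : ℝ) : ℂ)) =
        ∫ ξ : E d, trigEval ξ q * trigSeries a ξ * ((negHat d c ‖ξ‖ : ℝ) : ℂ) := by
      refine integral_congr_ae (Eventually.of_forall fun ξ => ?_)
      simp only [hqe]; ring
    rw [h3, h2, h4, h1]
    have h5 : (((2 * Real.pi) ^ d : ℝ) : ℂ) * (((2 * Real.pi) ^ (-(d : ℝ)) : ℝ) : ℂ) = 1 := by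
      rw [← Complex.ofReal_mul, Real.rpow_neg (by positivity), Real.rpow_natCast,
        mul_inv_cancel₀ (by positivity), Complex.ofReal_one]
    linear_combination (-∫ ξ : E d, trigEval ξ q * trigSeries a ξ * ((negHat d c ‖ξ‖ : ℝ) : ℂ)) * h5
  filter_upwards [hae, ae_off_lattice hd] with ξ hξ hlat
  have hvper : ∀ k, ((vanishingFun (ξ + (2 * Real.pi) • lat k) : ℝ) : ℂ) =
      ((vanishingFun ξ : ℝ) : ℂ) := fun k => by
    rw [← trigEval_vanishingPoly, trigEval_add_lat, trigEval_vanishingPoly]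
  obtain ⟨k₀, hk₀⟩ := exists_add_lat_mem_periodCube_iff ξ
  have hterm : ∀ k, ((vanishingFun (ξ + (2 * Real.pi) • lat k) : ℝ) : ℂ) *
      trigSeries a (ξ + (2 * Real.pi) • lat k) *
        ((negHat d c ‖ξ + (2 * Real.pi) • lat k‖ : ℝ) : ℂ) +
      (periodCube d).indicator (fun ξ => ((vanishingFun ξ : ℝ) : ℂ)) (ξ + (2 * Real.pi) • lat k) =
      ((vanishingFun ξ : ℝ) : ℂ) * trigSeries a ξ *
        ((negHat d c ‖ξ + (2 * Real.pi) • lat k‖ : ℝ) : ℂ) +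
      if k = k₀ then ((vanishingFun ξ : ℝ) : ℂ) else 0 := fun k => by
    rw [hvper, trigSeries_add_lat]
    congr 1
    by_cases hk : k = k₀
    · rw [indicator_of_mem ((hk₀ k).2 hk), hvper, if_pos hk]
    · rw [indicator_of_notMem ((hk₀ k).not.2 hk), if_neg hk]
  simp only [hterm] at hξ
  have hsum : Summable fun k : Fin d → ℤ => ((negHat d c ‖ξ + (2 * Real.pi) • lat k‖ : ℝ) : ℂ) :=
    Complex.summable_ofReal.2 (summable_negHat_add_lat hc ξ)
  rw [(hsum.mul_left _).tsum_add ((hasSum_ite_eq k₀ _).summable), tsum_mul_left, tsum_ite_eq,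
    ← Complex.ofReal_tsum] at hξ
  have hv : ((vanishingFun ξ : ℝ) : ℂ) ≠ 0 := by exact_mod_cast vanishingFun_ne_zero hlat
  refine mul_left_cancel₀ hv ?_
  linear_combination hξ

theorem ae_trigSeries_mul_negHat (hd : 0 < d) (hc : 0 < c)
    (ha : ∀ x : E d, Summable fun j => a j * multiquadric c ‖x - lat j‖)
    (hδ : ∀ k : Fin d → ℤ, ∑' j, a j * multiquadric c ‖(lat k : E d) - lat j‖ = if k =
        0 then 1 else 0) :
    ∀ᵐ ξ : E d, trigSeries a ξ * ((negHat d c ‖ξ‖ : ℝ) : ℂ) = -((cardinalHat d c ξ : ℝ) : ℂ) := by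
  filter_upwards [ae_trigSeries_mul_tsum hd hc ha hδ, ae_off_lattice hd] with ξ hξ hlat
  rw [cardinalHat_of_off_lattice hlat]
  have h1 := (tsum_negHat_pos hc hlat).ne'
  have h2 : ((∑' k : Fin d → ℤ, negHat d c ‖ξ + (2 * Real.pi) • lat k‖ : ℝ) : ℂ) ≠ 0 := by
    exact_mod_cast h1
  rw [Complex.ofReal_div]
  field_simp
  linear_combination ((negHat d c ‖ξ‖ : ℝ) : ℂ) * hξ

/-- The coefficients of a cardinal function sum to zero, since `|A| ≤ 1 / |φ̂_c|`. -/
theorem tsum_coeff_eq_zero (hd : 0 < d) (hc : 0 < c)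
    (ha : ∀ x : E d, Summable fun j => a j * multiquadric c ‖x - lat j‖)
    (hδ : ∀ k : Fin d → ℤ, ∑' j, a j * multiquadric c ‖(lat k : E d) - lat j‖ = if k =
        0 then 1 else 0) :
    ∑' j, (a j : ℂ) = 0 := by
  have hAbs := summable_abs_of_summable_mul_multiquadric hc (ha 0)
  have hne : Nonempty (Fin d) := ⟨⟨0, hd⟩⟩
  have hclosed : IsClosed {ξ : E d | ‖trigSeries a ξ‖ ≤ (negHat d c ‖ξ‖)⁻¹} :=
    isClosed_le (continuous_trigSeries hAbs).norm (continuous_inv_negHat_norm hc)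
  have hdense : Dense {ξ : E d | ‖trigSeries a ξ‖ ≤ (negHat d c ‖ξ‖)⁻¹} := by
    refine Measure.dense_of_ae (μ := volume) ?_
    filter_upwards [ae_trigSeries_mul_negHat hd hc ha hδ, ae_off_lattice hd] with ξ hξ hlat
    have hpos := negHat_pos (d := d) hc (norm_pos_iff.2 (by simpa using hlat 0))
    have h1 := congrArg norm hξ
    rw [norm_mul, norm_neg, Complex.norm_real, Complex.norm_real, Real.norm_of_nonneg hpos.le,
      Real.norm_of_nonneg (cardinalHat_nonneg hc ξ)] at h1
    rw [← one_div, le_div_iff₀ hpos, h1]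
    exact cardinalHat_le_one hc ξ
  have h0 : (0 : E d) ∈ {ξ : E d | ‖trigSeries a ξ‖ ≤ (negHat d c ‖ξ‖)⁻¹} := by
    rw [← hclosed.closure_eq]; exact hdense 0
  simp only [mem_ofPred_eq, norm_zero, negHat_zero, inv_zero] at h0
  have h1 := norm_le_zero_iff.1 h0
  simpa [trigSeries] using h1

end Series

/-- A cardinal function is the inverse Fourier integral of `χ̂_c`. -/
theorem IsCardinalFunction.eq_integral (hd : 0 < d) (hc : 0 < c) {χ : E d → ℝ}
    (hχ : IsCardinalFunction (multiquadric c) χ) (x : E d) :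
    ((χ x : ℝ) : ℂ) = (((2 * Real.pi) ^ (-(d : ℝ)) : ℝ) : ℂ) *
      ∫ ξ : E d, ((cardinalHat d c ξ : ℝ) : ℂ) * planeWave x ξ := by
  obtain ⟨a, hsum, hδ⟩ := hχ
  have ha : ∀ x : E d, Summable fun j => a j * multiquadric c ‖x - lat j‖ :=
      fun x => (hsum x).summable
  have hδ' : ∀ k : Fin d → ℤ, ∑' j, a j * multiquadric c ‖(lat k : E d) - lat j‖ =
      if k = 0 then 1 else 0 := fun k => by rw [(hsum _).tsum_eq, hδ]
  have hAbs := summable_abs_of_summable_mul_multiquadric hc (ha 0)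
  have hu : ∀ ξ : E d, ∑' j, (a j : ℂ) * planeWave (x - lat j) ξ =
      planeWave x ξ * trigSeries a ξ := fun ξ => by
    rw [trigSeries, ← tsum_mul_left]
    refine tsum_congr fun j => ?_
    rw [sub_eq_add_neg, ← lat_neg, planeWave_add_left]
    ring
  have hae : (fun ξ : E d => (∑' j, (a j : ℂ) * planeWave (x - lat j) ξ) *
      ((negHat d c ‖ξ‖ : ℝ) : ℂ)) =ᵐ[volume]
      fun ξ => -(((cardinalHat d c ξ : ℝ) : ℂ) * planeWave x ξ) := by
    filter_upwards [ae_trigSeries_mul_negHat hd hc ha hδ'] with ξ hξ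
    rw [hu, mul_assoc, hξ]
    ring
  have hint : Integrable fun ξ : E d => ((cardinalHat d c ξ : ℝ) : ℂ) * planeWave x ξ :=
    (integrable_cardinalHat hc).ofReal.mul_bdd (c := 1)
      (continuous_planeWave_right _).aestronglyMeasurable
      (Eventually.of_forall fun ξ => (norm_planeWave _ _).le)
  have key := tsum_mul_multiquadric (w := fun j => (a j : ℂ)) (p := fun j => x - lat j) hd hc
    (by simpa using hAbs) (by simpa using (ha x).abs) (tsum_coeff_eq_zero hd hc ha hδ')
    (hint.neg.congr hae.symm)
  rw [integral_congr_ae hae, integral_neg, mul_neg, neg_mul, neg_neg] at key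
  rw [← key, ← (hsum x).tsum_eq, Complex.ofReal_tsum]
  refine tsum_congr fun j => ?_
  push_cast
  rfl

/-! ### Fourier transforms of the multiquadric and of cardinal functions -/

theorem two_pi_rpow_neg (d : ℕ) : ((2 * Real.pi) ^ (-(d : ℝ)) : ℝ) = ((2 * Real.pi) ^ d)⁻¹ := by
  rw [Real.rpow_neg (by positivity), Real.rpow_natCast]

theorem fourierInt_eq_fourier (f : E d → ℂ) (ξ : E d) :
    fourierInt f ξ = 𝓕 f ((2 * Real.pi)⁻¹ • ξ) := by
  rw [fourierInt, Real.fourier_eq']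
  refine integral_congr_ae (Eventually.of_forall fun x => ?_)
  simp only [inner_smul_right, smul_eq_mul]
  rw [mul_comm]
  congr 2
  push_cast
  field_simp

theorem integral_smul_mul_planeWave (g : E d → ℂ) (ξ : E d) :
    ∫ x, g ((2 * Real.pi)⁻¹ • x) * planeWave x ξ = (((2 * Real.pi) ^ d : ℝ) : ℂ) * 𝓕⁻ g ξ := by
  have h1 := Measure.integral_comp_smul (volume : Measure (E d))
    (fun y => g y * planeWave ((2 * Real.pi) • y) ξ) (2 * Real.pi)⁻¹
  simp only [smul_smul, mul_inv_cancel₀ Real.two_pi_pos.ne', one_smul] at h1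
  rw [h1, Real.fourierInv_eq', finrank_euclideanSpace_fin, inv_pow, inv_inv,
    abs_of_pos (by positivity), Complex.real_smul]
  congr 1
  refine integral_congr_ae (Eventually.of_forall fun x => ?_)
  simp only [planeWave, inner_smul_left, smul_eq_mul]
  rw [mul_comm]
  simp [mul_comm]

theorem integral_fourierInt_mul_planeWave (ψ : 𝓢(E d, ℂ)) (ξ : E d) :
    ∫ x, fourierInt ψ x * planeWave x ξ = (((2 * Real.pi) ^ d : ℝ) : ℂ) * ψ ξ := by
  simp_rw [fourierInt_eq_fourier]
  rw [integral_smul_mul_planeWave, ← SchwartzMap.fourier_coe, ← SchwartzMap.fourierInv_coe,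
    FourierTransform.fourierInv_fourier_eq]

theorem integrable_norm_mul_fourierInt (ψ : 𝓢(E d, ℂ)) :
    Integrable (fun x => ‖x‖ * ‖fourierInt ψ x‖) := by
  have h := ((𝓕 ψ).integrable_pow_mul volume 1).comp_smul (inv_ne_zero Real.two_pi_pos.ne')
  refine (h.const_mul (2 * Real.pi)).congr (Eventually.of_forall fun x => ?_)
  simp only [fourierInt_eq_fourier, SchwartzMap.fourier_coe, pow_one, norm_smul, norm_inv,
    Real.norm_of_nonneg Real.two_pi_pos.le]
  field_simp

theorem integrable_fourierInt (ψ : 𝓢(E d, ℂ)) : Integrable (fourierInt ψ) := by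
  refine ((𝓕 ψ).integrable.comp_smul (inv_ne_zero Real.two_pi_pos.ne')).congr
    (Eventually.of_forall fun x => ?_)
  simp only [fourierInt_eq_fourier, SchwartzMap.fourier_coe]

theorem multiquadric_le (hc : 0 < c) {r : ℝ} (hr : 0 ≤ r) : multiquadric c r ≤ r + c := by
  rw [multiquadric, Real.sqrt_le_iff]
  constructor <;> nlinarith

theorem isGeneralizedFourierTransform_multiquadric (hd : 0 < d) (hc : 0 < c) :
    IsGeneralizedFourierTransform (fun x : E d => multiquadric c ‖x‖)
      (fun ξ : E d => multiquadricHat d c ‖ξ‖) := by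
  intro ψ hψ
  have hF := integrable_fourierInt ψ
  have hmq : Continuous fun x : E d => ((multiquadric c ‖x‖ : ℝ) : ℂ) := by
    unfold multiquadric; fun_prop
  have hFφ : Integrable fun x => fourierInt ψ x * ((multiquadric c ‖x‖ : ℝ) : ℂ) := by
    refine ((integrable_norm_mul_fourierInt ψ).add (hF.norm.const_mul c)).mono'
      (hF.aestronglyMeasurable.mul hmq.aestronglyMeasurable) (Eventually.of_forall fun x => ?_)
    rw [norm_mul, Complex.norm_real,
      Real.norm_of_nonneg (show 0 ≤ multiquadric c ‖x‖ from Real.sqrt_nonneg _)]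
    have := mul_le_mul_of_nonneg_left (multiquadric_le hc (norm_nonneg x))
      (norm_nonneg (fourierInt ψ x))
    simp only [Pi.add_apply]
    linarith
  have hψM : Integrable fun ξ : E d => ψ ξ * ((negHat d c ‖ξ‖ : ℝ) : ℂ) := by
    obtain ⟨ε, hε, hball⟩ := Metric.isOpen_iff.1 (isClosed_tsupport (ψ : E d → ℂ)).isOpen_compl 0 hψ
    have hneg := (negHat_pos (d := d) hc hε).le
    refine (ψ.integrable.norm.mul_const (negHat d c ε)).mono' (ψ.integrable.aestronglyMeasurable.mul
      (Complex.measurable_ofReal.comp (measurable_negHat_norm hc)).aestronglyMeasurable)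
      (Eventually.of_forall fun ξ => ?_)
    rw [norm_mul, Complex.norm_real, Real.norm_of_nonneg (negHat_nonneg hc (norm_nonneg _))]
    rcases lt_or_ge ‖ξ‖ ε with hlt | hge
    · have : ψ ξ = 0 := image_eq_zero_of_notMem_tsupport (hball (by simpa using hlt))
      simp [this]
    · refine mul_le_mul_of_nonneg_left ((negHat_le_exp_mul hc hε hge).trans ?_) (norm_nonneg _)
      refine mul_le_of_le_one_left hneg (Real.exp_le_one_iff.2 ?_)
      nlinarith
  have h0 : ∫ x, fourierInt ψ x = 0 := by
    have h1 := integral_fourierInt_mul_planeWave ψ 0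
    rw [image_eq_zero_of_notMem_tsupport hψ, mul_zero] at h1
    simpa using h1
  have key := integral_mul_multiquadric hd hc (μ := volume) (w := fourierInt ψ) (p := id)
    measurable_id hF hFφ h0 (by
      simp only [id, integral_fourierInt_mul_planeWave]
      simpa only [mul_assoc] using hψM.const_mul (((2 * Real.pi) ^ d : ℝ) : ℂ))
  simp only [id, integral_fourierInt_mul_planeWave] at key
  refine ⟨by simpa only [mul_comm] using hFφ, ?_, ?_⟩
  · refine hψM.neg.congr (Eventually.of_forall fun ξ => ?_)
    simp only [multiquadricHat_eq_neg, Pi.neg_apply]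
    push_cast
    ring
  · simp_rw [mul_comm (((multiquadric c _ : ℝ)) : ℂ), multiquadricHat_eq_neg]
    rw [key]
    have h2 : ∫ ξ : E d, (((2 * Real.pi) ^ d : ℝ) : ℂ) * ψ ξ * ((negHat d c ‖ξ‖ : ℝ) : ℂ) =
        (((2 * Real.pi) ^ d : ℝ) : ℂ) * ∫ ξ : E d, ψ ξ * ((negHat d c ‖ξ‖ : ℝ) : ℂ) := by
      rw [← integral_const_mul]; simp only [mul_assoc]
    have h3 : ∫ ξ : E d, ((-negHat d c ‖ξ‖ : ℝ) : ℂ) * ψ ξ =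
        -∫ ξ : E d, ψ ξ * ((negHat d c ‖ξ‖ : ℝ) : ℂ) := by
      rw [← integral_neg]
      refine integral_congr_ae (Eventually.of_forall fun ξ => ?_)
      push_cast
      ring
    rw [h2, h3, two_pi_rpow_neg, ← mul_assoc, neg_mul, ← Complex.ofReal_mul,
      inv_mul_cancel₀ (by positivity)]
    simp

section Cardinal

variable {χ : E d → ℝ}

theorem IsCardinalFunction.eq_fourierInv (hd : 0 < d) (hc : 0 < c)
    (hχ : IsCardinalFunction (multiquadric c) χ) (x : E d) :
    ((χ x : ℝ) : ℂ) = 𝓕⁻ (fun y : E d => ((cardinalHat d c ((2 * Real.pi) • y) : ℝ) : ℂ)) x := by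
  rw [hχ.eq_integral hd hc x]
  have h1 := integral_smul_mul_planeWave
    (fun y : E d => ((cardinalHat d c ((2 * Real.pi) • y) : ℝ) : ℂ)) x
  simp only [smul_smul, mul_inv_cancel₀ Real.two_pi_pos.ne', one_smul] at h1
  simp_rw [planeWave_comm x]
  rw [h1, two_pi_rpow_neg, ← mul_assoc, ← Complex.ofReal_mul, inv_mul_cancel₀ (by positivity),
    Complex.ofReal_one, one_mul]

theorem IsCardinalFunction.fourierInt_eq (hd : 0 < d) (hc : 0 < c)
    (hχ : IsCardinalFunction (multiquadric c) χ) (hint : Integrable χ) (ξ : E d) :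
    fourierInt (fun x => (χ x : ℂ)) ξ = (cardinalHat d c ξ : ℂ) := by
  set H : E d → ℂ := fun y => ((cardinalHat d c ((2 * Real.pi) • y) : ℝ) : ℂ) with hH
  have hHc : Continuous H := by
    have := continuous_cardinalHat (d := d) hc
    fun_prop
  have hHi : Integrable H :=
    ((integrable_cardinalHat (d := d) hc).comp_smul Real.two_pi_pos.ne').ofReal
  have heq : (fun x => ((χ x : ℝ) : ℂ)) = 𝓕⁻ H := funext fun x => hχ.eq_fourierInv hd hc x
  have hFi : Integrable (𝓕 H) := by
    have h1 : Integrable (𝓕⁻ H) := heq ▸ hint.ofReal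
    refine h1.comp_neg.congr (Eventually.of_forall fun x => ?_)
    simp [Real.fourierInv_eq_fourier_neg]
  rw [fourierInt_eq_fourier, heq, hHc.fourier_fourierInv_eq hHi hFi]
  simp only [hH, smul_smul, mul_inv_cancel₀ Real.two_pi_pos.ne', one_smul]

theorem IsCardinalFunction.isFourierTransform (hd : 0 < d) (hc : 0 < c)
    (hχ : IsCardinalFunction (multiquadric c) χ) : IsFourierTransform χ (cardinalHat d c) := by
  intro ψ
  have hh := (integrable_cardinalHat (d := d) hc).ofReal (𝕜 := ℂ)
  have hF := integrable_fourierInt ψ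
  have hprod : Integrable (fun z : E d × E d => ((cardinalHat d c z.2 : ℝ) : ℂ) *
      planeWave z.1 z.2 * fourierInt ψ z.1) (volume.prod volume) := by
    have h1 : Integrable (fun z : E d × E d => planeWave z.1 z.2 *
        (fourierInt ψ z.1 * ((cardinalHat d c z.2 : ℝ) : ℂ))) (volume.prod volume) :=
      (hF.mul_prod hh).bdd_mul (c := 1)
        (measurable_planeWave measurable_fst measurable_snd).aestronglyMeasurable
        (Eventually.of_forall fun z => (norm_planeWave _ _).le)
    refine h1.congr (Eventually.of_forall fun z => ?_)
    simp only
    ring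
  have hleft : ∀ x, ((χ x : ℝ) : ℂ) * fourierInt ψ x = (((2 * Real.pi) ^ (-(d : ℝ)) : ℝ) : ℂ) *
      ∫ ξ : E d, ((cardinalHat d c ξ : ℝ) : ℂ) * planeWave x ξ * fourierInt ψ x := fun x => by
    rw [hχ.eq_integral hd hc x, mul_assoc, integral_mul_const]
  refine ⟨?_, ?_, ?_⟩
  · simp_rw [hleft]
    exact hprod.integral_prod_left.const_mul _
  · refine (ψ.integrable (μ := volume)).bdd_mul (c := 1)
      (Complex.continuous_ofReal.comp (continuous_cardinalHat hc)).aestronglyMeasurable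
      (Eventually.of_forall fun ξ => ?_)
    rw [Complex.norm_real, Real.norm_of_nonneg (cardinalHat_nonneg hc ξ)]
    exact cardinalHat_le_one hc ξ
  · simp_rw [hleft]
    rw [integral_const_mul, integral_integral_swap (f := fun x ξ =>
      ((cardinalHat d c ξ : ℝ) : ℂ) * planeWave x ξ * fourierInt ψ x) hprod, ← integral_const_mul]
    refine integral_congr_ae (Eventually.of_forall fun ξ => ?_)
    have h1 : ∫ x, ((cardinalHat d c ξ : ℝ) : ℂ) * planeWave x ξ * fourierInt ψ x =
        ((cardinalHat d c ξ : ℝ) : ℂ) * ((((2 * Real.pi) ^ d : ℝ) : ℂ) * ψ ξ) := by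
      rw [← integral_fourierInt_mul_planeWave, ← integral_const_mul]
      refine integral_congr_ae (Eventually.of_forall fun x => ?_)
      simp only
      ring
    have h2 : (((2 * Real.pi) ^ (-(d : ℝ)) : ℝ) : ℂ) * (((2 * Real.pi) ^ d : ℝ) : ℂ) = 1 := by
      rw [← Complex.ofReal_mul, two_pi_rpow_neg, inv_mul_cancel₀ (by positivity),
        Complex.ofReal_one]
    simp only
    rw [h1]
    linear_combination (((cardinalHat d c ξ : ℝ) : ℂ) * ψ ξ) * h2

end Cardinal

/-! ### The one-dimensional limit -/

theorem integral_indicator_cube_mul_planeWave (x : E 1) :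
    ∫ ξ : E 1, (((cube 1).indicator (fun _ => (1 : ℝ)) ξ : ℝ) : ℂ) * planeWave x ξ =
      ((2 * Real.pi * Real.sinc (Real.pi * x 0) : ℝ) : ℂ) := by
  have h1 := (PiLp.volume_preserving_toLp (Fin 1)).integral_comp
    (MeasurableEquiv.toLp 2 _).measurableEmbedding
    (fun ξ : E 1 => (((cube 1).indicator (fun _ => (1 : ℝ)) ξ : ℝ) : ℂ) * planeWave x ξ)
  have h2 := (volume_preserving_funUnique (Fin 1) ℝ).symm.integral_comp
    (MeasurableEquiv.measurableEmbedding _)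
    (fun y : Fin 1 → ℝ => (((cube 1).indicator (fun _ => (1 : ℝ)) (WithLp.toLp 2 y) : ℝ) : ℂ) *
      planeWave x (WithLp.toLp 2 y))
  refine h1.symm.trans (h2.symm.trans ?_)
  have h3 : ∀ t : ℝ, (((cube 1).indicator (fun _ => (1 : ℝ))
      (WithLp.toLp 2 ((MeasurableEquiv.funUnique (Fin 1) ℝ).symm t)) : ℝ) : ℂ) *
      planeWave x (WithLp.toLp 2 ((MeasurableEquiv.funUnique (Fin 1) ℝ).symm t)) =
      (Icc (-Real.pi) Real.pi).indicator (fun t => Complex.exp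
          (((x 0 * t : ℝ) : ℂ) * Complex.I)) t := by
    intro t
    have hinner : planeWave x (WithLp.toLp 2 ((MeasurableEquiv.funUnique (Fin 1) ℝ).symm t)) =
        Complex.exp (((x 0 * t : ℝ) : ℂ) * Complex.I) := by
      rw [planeWave, mul_comm]
      congr 3
      simp only [PiLp.inner_apply, RCLike.inner_apply, conj_trivial]
      simp [mul_comm]
    by_cases ht : t ∈ Icc (-Real.pi) Real.pi
    · have hm : (WithLp.toLp 2 ((MeasurableEquiv.funUnique (Fin 1) ℝ).symm t) : E 1) ∈ cube 1 :=
        fun i => ht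
      rw [indicator_of_mem ht, indicator_of_mem hm, hinner]
      simp
    · have hm : (WithLp.toLp 2 ((MeasurableEquiv.funUnique (Fin 1) ℝ).symm t) : E 1) ∉ cube 1 :=
        fun h => ht (h 0)
      rw [indicator_of_notMem ht, indicator_of_notMem hm]
      simp
  simp_rw [h3]
  rw [integral_indicator measurableSet_Icc, integral_Icc_eq_integral_Ioc,
    ← intervalIntegral.integral_of_le (by linarith [Real.pi_pos])]
  by_cases hx : x 0 = 0
  · simp [hx]
    ring
  · have h4 := intervalIntegral.integral_comp_mul_left (a := -Real.pi) (b := Real.pi)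
      (fun s : ℝ => Complex.exp ((s : ℂ) * Complex.I)) hx
    rw [h4, mul_neg, integral_exp_mul_I_eq_sinc, Complex.real_smul, mul_comm (x 0) Real.pi]
    push_cast
    have : ((x 0 : ℝ) : ℂ) ≠ 0 := by exact_mod_cast hx
    field_simp

theorem norm_ofLp_eq_norm (ξ : E 1) : ‖WithLp.ofLp ξ‖ = ‖ξ‖ := by
  rw [EuclideanSpace.norm_eq, Fin.sum_univ_one, Real.sqrt_sq (norm_nonneg _)]
  refine le_antisymm ((pi_norm_le_iff_of_nonneg (norm_nonneg _)).2 fun i => ?_)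
    (norm_le_pi_norm (WithLp.ofLp ξ) 0)
  rw [Subsingleton.elim i 0]

theorem tendsto_cardinalFunction {χ : ℝ → E 1 → ℝ}
    (hχ : ∀ c : ℝ, 0 < c → IsCardinalFunction (multiquadric c) (χ c)) (x : E 1) :
    Tendsto (fun c : ℝ => χ c x) atTop (𝓝 (Real.sinc (Real.pi * x 0))) := by
  have hae : ∀ᵐ ξ : E 1, ‖WithLp.ofLp ξ‖ ≠ Real.pi := by
    have h1 : (volume : Measure (E 1)) (Metric.sphere 0 Real.pi) = 0 :=
      Measure.addHaar_sphere_of_ne_zero _ _ Real.pi_ne_zero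
    rw [ae_iff]
    refine measure_mono_null (fun ξ hξ => ?_) h1
    simp only [ne_eq, not_not, mem_ofPred_eq, norm_ofLp_eq_norm] at hξ
    simpa using hξ
  have hlim : Tendsto (fun c : ℝ => ∫ ξ : E 1, ((cardinalHat 1 c ξ : ℝ) : ℂ) * planeWave x ξ) atTop
      (𝓝 (∫ ξ : E 1, (((cube 1).indicator (fun _ => (1 : ℝ)) ξ : ℝ) : ℂ) * planeWave x ξ)) := by
    refine tendsto_integral_filter_of_dominated_convergence
      (fun ξ => Real.exp Real.pi * Real.exp (-(1 * ‖ξ‖))) ?_ ?_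
      ((integrable_exp_neg_norm one_pos 1).const_mul _) ?_
    · filter_upwards [eventually_gt_atTop 0] with c hc
      exact ((Complex.continuous_ofReal.comp (continuous_cardinalHat hc)).mul
        (continuous_planeWave_right x)).aestronglyMeasurable
    · filter_upwards [eventually_ge_atTop 1] with c hc
      have hc0 : 0 < c := one_pos.trans_le hc
      refine Eventually.of_forall fun ξ => ?_
      rw [norm_mul, norm_planeWave, mul_one, Complex.norm_real,
        Real.norm_of_nonneg (cardinalHat_nonneg hc0 ξ), ← Real.exp_add]
      rcases le_total ‖ξ‖ Real.pi with h | h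
      · exact (cardinalHat_le_one hc0 ξ).trans (Real.one_le_exp (by linarith))
      · refine (cardinalHat_le_exp hc0 ξ).trans (Real.exp_le_exp.2 ?_)
        push_cast
        nlinarith
    · filter_upwards [hae] with ξ hξ
      exact ((Complex.continuous_ofReal.tendsto _).comp
        (tendsto_cardinalHat one_pos hξ)).mul_const _
  rw [integral_indicator_cube_mul_planeWave] at hlim
  have h2 := hlim.const_mul (((2 * Real.pi) ^ (-((1 : ℕ) : ℝ)) : ℝ) : ℂ)
  rw [← Complex.ofReal_mul, two_pi_rpow_neg, pow_one, ← mul_assoc,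
    inv_mul_cancel₀ Real.two_pi_pos.ne', one_mul] at h2
  have h3 : Tendsto (fun c : ℝ => ((χ c x : ℝ) : ℂ)) atTop
      (𝓝 ((Real.sinc (Real.pi * x 0) : ℝ) : ℂ)) := by
    refine h2.congr' ?_
    filter_upwards [eventually_gt_atTop 0] with c hc
    rw [(hχ c hc).eq_integral one_pos hc x, two_pi_rpow_neg, pow_one]
  exact (Complex.continuous_re.tendsto _).comp h3

end MQ

end

theorem proposition7p2p2 (d : ℕ) (hd : 0 < d) :
    -- the generalized Fourier transform of the multiquadric, and continuity of the quotient
    (∀ c : ℝ, 0 < c →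
      MQ.IsGeneralizedFourierTransform (fun x : MQ.E d => MQ.multiquadric c ‖x‖)
        (fun ξ : MQ.E d => MQ.multiquadricHat d c ‖ξ‖) ∧
      (∀ ξ : MQ.E d, (∀ k : Fin d → ℤ, ξ + (2 * Real.pi) • MQ.lat k ≠ 0) →
        Summable (fun k : Fin d → ℤ => MQ.multiquadricHat d c ‖ξ + (2 * Real.pi) • MQ.lat k‖) ∧
        ∑' k : Fin d → ℤ, MQ.multiquadricHat d c ‖ξ + (2 * Real.pi) • MQ.lat k‖ ≠ 0) ∧
      Continuous (MQ.cardinalHat d c)) ∧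
    -- the quotient is the Fourier transform of the multiquadric cardinal function
    (∀ c : ℝ, 0 < c → ∀ χ : MQ.E d → ℝ, MQ.IsCardinalFunction (MQ.multiquadric c) χ →
      MQ.IsFourierTransform χ (MQ.cardinalHat d c) ∧
      (MeasureTheory.Integrable χ → ∀ ξ : MQ.E d,
        MQ.fourierInt (fun x => (χ x : ℂ)) ξ = (MQ.cardinalHat d c ξ : ℂ))) ∧
    -- its limit as `c → ∞`
    (∀ ξ : MQ.E d, ‖WithLp.ofLp ξ‖ ≠ Real.pi →
      Filter.Tendsto (fun c : ℝ => MQ.cardinalHat d c ξ) Filter.atTop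
        (𝓝 ((MQ.cube d).indicator (fun _ => (1 : ℝ)) ξ))) ∧
    -- in dimension one the cardinal functions converge to the sinc function
    (d = 1 → ∀ χ : ℝ → MQ.E d → ℝ,
      (∀ c : ℝ, 0 < c → MQ.IsCardinalFunction (MQ.multiquadric c) (χ c)) →
      ∀ x : MQ.E d, Filter.Tendsto (fun c : ℝ => χ c x) Filter.atTop
        (𝓝 (Real.sinc (Real.pi * x ⟨0, hd⟩)))) := by
  refine ⟨fun c hc => ⟨MQ.isGeneralizedFourierTransform_multiquadric hd hc, fun ξ hξ => ?_,
    MQ.continuous_cardinalHat hc⟩, fun c hc χ hχ => ⟨hχ.isFourierTransform hd hc,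
    hχ.fourierInt_eq hd hc⟩, fun ξ hξ => MQ.tendsto_cardinalHat hd hξ, ?_⟩
  · simp_rw [MQ.multiquadricHat_eq_neg]
    refine ⟨(MQ.summable_negHat_add_lat hc ξ).neg, ?_⟩
    rw [tsum_neg]
    exact neg_ne_zero.2 (MQ.tsum_negHat_pos hc hξ).ne'
  · rintro rfl χ hχ x
    exact MQ.tendsto_cardinalFunction hχ x
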